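/- Call a sequence of reals $(r_n)_{n\in\mathbb N}$ computable if some algorithm computes from $n,k\in\mathbb N$ a rational $q$ with $|r_n-q|\le 2^{-k}$. A Martin-Löf test is a decreasing sequence of open sets $U_n=\bigcup_{k\in\mathbb N} I_{n,k}$, where $(I_{n,k})$ is a computable double sequence of (possibly empty) open intervals with rational endpoints and the Lebesgue measures $\lambda(U_n)$ are bounded above by a computable sequence of reals that converges to $0$. It is a Schnorr test if moreover the sequence of reals $(\lambda(U_n))_n$ is computable. A real $x$ is Martin-Löf random (Schnorr random) if $x\notin\bigcap_n U_n$ for every Martin-Löf test (Schnorr test) $(U_n)$. A sequence of reals $(x_n)_{n\ge1}$ is uniformly distributed (u.d.) mod $1$ if $\lim_{N\to\infty}\frac1N\#\{n: 1\le n\le N,\ \{x_n\}\in[a,b)\}=b-a$ for all $0\le a\le b\le 1$, where $\{x_n\}$ is the fractional part of $x_n$. A sequence of functions $u_n:[0,1]\to\mathbb R$ ($n\ge1$) is computable if approximations of $u_n(q)$ up to $2^{-k}$ can be computed uniformly in $n$, $k$ and rational $q\in[0,1]$, and there is a computable function $d:\mathbb N\times\mathbb N\to\mathbb N$ such that $|x-y|\le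 2^{-d(n,k)}$ implies $|u_n(x)-u_n(y)|\le2^{-k}$ for all $x,y\in[0,1]$. It is Koksma if every $u_n$ is continuously differentiable on $[0,1]$, each difference $u_m'-u_n'$ is monotone (non-decreasing or non-increasing) on $[0,1]$, and there is $K>0$ such that $|u_m'(x)-u_n'(x)|\ge K$ for all $m\neq n$ and all $x\in[0,1]$. It is effective Koksma if it is Koksma and both $(u_n)_{n\ge1}$ and $(u_n')_{n\ge1}$ are computable. A real $x\in[0,1]$ is effective Koksma u.d. if $(u_n(x))_{n\ge1}$ is u.d. mod $1$ for every effective Koksma sequence $(u_n)_{n\ge1}$. **Theorem.** Every Schnorr random real $x\in[0,1]$ is effective Koksma u.d. A fortiori, every Martin-Löf random real $x\in[0,1]$ is effective Koksma u.d. -/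

import Mathlib

open Set Filter Topology MeasureTheory

/-! ### Rationals and computable real numbers -/

/-- The rational number `(a - b) / (c + 1)` named by the triple `(a, b, c)` of natural numbers.
Every rational has a name, and `Computable` (Mathlib's notion of a total recursive function)
makes sense for functions into and out of names. -/
def ratOfCode (c : ℕ × ℕ × ℕ) : ℚ := ((c.1 : ℚ) - (c.2.1 : ℚ)) / ((c.2.2 : ℚ) + 1)

/-- A sequence of reals is computable if some algorithm computes, from `n` and `k`, a rational
that approximates `r n` up to `2 ^ (-k)`. -/
def ComputableRealSeq (r : ℕ → ℝ) : Prop :=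
  ∃ f : ℕ × ℕ → ℕ × ℕ × ℕ, Computable f ∧
    ∀ n k : ℕ, |r n - (ratOfCode (f (n, k)) : ℝ)| ≤ (1 / 2 : ℝ) ^ k

/-! ### Martin-Löf and Schnorr randomness -/

/-- `U n = ⋃ k, I (n, k)` for a computable double sequence `I (n, k)` of (possibly empty) open
intervals with rational endpoints: the sets `U n` are computably enumerable open sets of reals,
uniformly in `n`. -/
def UniformlyCEOpen (U : ℕ → Set ℝ) : Prop :=
  ∃ f : ℕ × ℕ → (ℕ × ℕ × ℕ) × (ℕ × ℕ × ℕ), Computable f ∧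
    ∀ n : ℕ, U n =
      ⋃ k : ℕ, Ioo (ratOfCode (f (n, k)).1 : ℝ) (ratOfCode (f (n, k)).2 : ℝ)

/-- A Martin-Löf test: a decreasing sequence of uniformly computably enumerable open sets whose
Lebesgue measures are bounded by a computable sequence that converges to `0`. -/
structure IsMartinLofTest (U : ℕ → Set ℝ) : Prop where
  ceOpen : UniformlyCEOpen U
  antitone : Antitone U
  measure_le : ∃ g : ℕ → ℝ, ComputableRealSeq g ∧ Tendsto g atTop (𝓝 0) ∧
    ∀ n, volume (U n) ≤ ENNReal.ofReal (g n)

/-- A Schnorr test: a Martin-Löf test whose sequence of Lebesgue measures (which are finite) is a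
computable sequence of reals. -/
structure IsSchnorrTest (U : ℕ → Set ℝ) : Prop extends IsMartinLofTest U where
  measure_computable : ComputableRealSeq fun n => (volume (U n)).toReal

/-- `x` passes every Martin-Löf test. -/
def MartinLofRandom (x : ℝ) : Prop :=
  ∀ U : ℕ → Set ℝ, IsMartinLofTest U → x ∉ ⋂ n, U n

/-- `x` passes every Schnorr test. -/
def SchnorrRandom (x : ℝ) : Prop :=
  ∀ U : ℕ → Set ℝ, IsSchnorrTest U → x ∉ ⋂ n, U n

/-! ### Uniform distribution modulo one

Sequences `(x_n)_{n ≥ 1}` are indexed from `0`: `x n` is the term `x_{n+1}`. -/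

/-- For every `[a, b) ⊆ [0, 1]`, the proportion of the first `N` terms whose fractional part lies
in `[a, b)` tends to `b - a`. -/
def UniformlyDistributedMod1 (x : ℕ → ℝ) : Prop :=
  ∀ a b : ℝ, 0 ≤ a → a ≤ b → b ≤ 1 →
    Tendsto (fun N : ℕ => (({n : ℕ | n < N ∧ Int.fract (x n) ∈ Ico a b}.ncard : ℕ) : ℝ) / (N : ℝ))
      atTop (𝓝 (b - a))

/-! ### Sequences of functions on the unit interval

A function `[0, 1] → ℝ` is given as a function `ℝ → ℝ` of which only the values on
`[0, 1]` matter; its derivative is `derivWithin _ (Icc 0 1)`, one-sided at the endpoints. -/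

/-- A sequence of functions on `[0, 1]` is computable (Grzegorczyk's definition): the values at
the rational points of `[0, 1]` are computable, and the functions have a computable modulus of
uniform continuity, both uniformly in `n`. -/
def ComputableFunSeq (u : ℕ → ℝ → ℝ) : Prop :=
  (∃ f : ℕ × (ℕ × ℕ × ℕ) × ℕ → ℕ × ℕ × ℕ, Computable f ∧
    ∀ (n : ℕ) (c : ℕ × ℕ × ℕ) (k : ℕ), (ratOfCode c : ℝ) ∈ Icc (0 : ℝ) 1 →
      |u n (ratOfCode c : ℝ) - (ratOfCode (f (n, c, k)) : ℝ)| ≤ (1 / 2 : ℝ) ^ k) ∧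
  (∃ d : ℕ × ℕ → ℕ, Computable d ∧
    ∀ (n k : ℕ), ∀ x ∈ Icc (0 : ℝ) 1, ∀ y ∈ Icc (0 : ℝ) 1,
      |x - y| ≤ (1 / 2 : ℝ) ^ d (n, k) → |u n x - u n y| ≤ (1 / 2 : ℝ) ^ k)

/-- The sequence of derivatives on `[0, 1]`. -/
noncomputable def unitDeriv (u : ℕ → ℝ → ℝ) (n : ℕ) (x : ℝ) : ℝ :=
  derivWithin (u n) (Icc 0 1) x

/-- `K`-Koksma sequences of functions on `[0, 1]`. -/
structure IsKoksmaWith (K : ℝ) (u : ℕ → ℝ → ℝ) : Prop where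
  contDiffOn : ∀ n, ContDiffOn ℝ 1 (u n) (Icc 0 1)
  monotone_sub : ∀ m n,
    MonotoneOn (fun x => unitDeriv u m x - unitDeriv u n x) (Icc 0 1) ∨
      AntitoneOn (fun x => unitDeriv u m x - unitDeriv u n x) (Icc 0 1)
  le_abs_sub : ∀ m n, m ≠ n → ∀ x ∈ Icc (0 : ℝ) 1, K ≤ |unitDeriv u m x - unitDeriv u n x|

/-- Koksma sequences of functions on `[0, 1]`. -/
def IsKoksma (u : ℕ → ℝ → ℝ) : Prop := ∃ K : ℝ, 0 < K ∧ IsKoksmaWith K u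

/-- Effective Koksma sequences: Koksma and computable, with computable sequence of derivatives. -/
structure IsEffectiveKoksma (u : ℕ → ℝ → ℝ) : Prop where
  koksma : IsKoksma u
  computable : ComputableFunSeq u
  computable_deriv : ComputableFunSeq (unitDeriv u)

/-- `x ∈ [0, 1]` is effective Koksma u.d.: `(u_n(x))` is u.d. mod 1 for every effective Koksma
sequence `(u_n)`. -/
def EffectiveKoksmaUD (x : ℝ) : Prop :=
  ∀ u : ℕ → ℝ → ℝ, IsEffectiveKoksma u → UniformlyDistributedMod1 fun n => u n x

/-! The argument makes Koksma's metric theorem effective. By Weyl's criterion it is enough that, for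
every frequency `h ≥ 1`, the exponential sums of `h * u n x` over `n < N` are `o(N)`. Since upper
bounds for `cos (2πh u n x + s)` at four phases `s` control both signs of the real and imaginary
parts, only one-sided estimates of cosine sums are needed.

Mean squares: a difference of two derivatives stays at distance `K` from 0, so it keeps its sign,
and the first `N` derivatives are ordered in the same way at every point. After reordering, the
`i`-th and `j`-th differ by at least `K|i - j|`. Van der Corput's estimate then bounds the
correlation integral of this pair by `1 / (K|i - j|)`, and the mean square of the sum is at most `N
+ (4 / K) N^(3/2)` (`IsKoksmaWith.integral_sq_sum_cos_le`).

Randomness: along `N = (j + 1)^4` the points with a sum above a fixed multiple of `N` form, by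
Markov's inequality, a set of measure `O(1 / (j + 1)^2)`. Rounding replaces this set by a finite
union of grid cells that an algorithm can list (`exists_computable_approx`). The measures have
explicit tails, so the unions over `j ≥ n` have computable measure and form a Schnorr test
(`isSchnorrTest_gridOpen`). A Schnorr random point thus lies in only finitely many of the sets.
Consecutive fourth powers have ratio tending to 1, so the bound extends to all `N`. -/

/-! ### Recursive arithmetic -/

namespace Computable

variable {α : Type*} [Primcodable α] {f g : α → ℕ}

theorem nat_add (hf : Computable f) (hg : Computable g) : Computable fun a => f a + g a :=
  Primrec.nat_add.to_comp.comp hf hg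

theorem nat_sub (hf : Computable f) (hg : Computable g) : Computable fun a => f a - g a :=
  Primrec.nat_sub.to_comp.comp hf hg

theorem nat_mul (hf : Computable f) (hg : Computable g) : Computable fun a => f a * g a :=
  Primrec.nat_mul.to_comp.comp hf hg

theorem nat_div (hf : Computable f) (hg : Computable g) : Computable fun a => f a / g a :=
  Primrec.nat_div.to_comp.comp hf hg

theorem nat_mod (hf : Computable f) (hg : Computable g) : Computable fun a => f a % g a :=
  Primrec.nat_mod.to_comp.comp hf hg

theorem nat_min (hf : Computable f) (hg : Computable g) : Computable fun a => min (f a) (g a) :=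
  Primrec.nat_min.to_comp.comp hf hg

theorem nat_sum_range {F : α → ℕ → ℕ} (hF : Computable₂ F) (hg : Computable g) :
    Computable fun a => ∑ i ∈ Finset.range (g a), F a i := by
  have hstep : Computable₂ fun (a : α) (p : ℕ × ℕ) => p.2 + F a p.1 :=
    nat_add (snd.comp snd) (hF.comp fst (fst.comp snd))
  refine (nat_rec hg (const 0) hstep).of_eq fun a => ?_
  induction g a with
  | zero => rfl
  | succ n ih => rw [Finset.sum_range_succ, ← ih]

theorem nat_prod_range {F : α → ℕ → ℕ} (hF : Computable₂ F) (hg : Computable g) :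
    Computable fun a => ∏ i ∈ Finset.range (g a), F a i := by
  have hstep : Computable₂ fun (a : α) (p : ℕ × ℕ) => p.2 * F a p.1 :=
    nat_mul (snd.comp snd) (hF.comp fst (fst.comp snd))
  refine (nat_rec hg (const 1) hstep).of_eq fun a => ?_
  induction g a with
  | zero => rfl
  | succ n ih => rw [Finset.prod_range_succ, ← ih]

theorem nat_pow (hf : Computable f) (hg : Computable g) : Computable fun a => f a ^ g a := by
  refine (nat_prod_range (F := fun a _ => f a) (hf.comp fst).to₂ hg).of_eq fun a => ?_
  simp

end Computable

/-! ### Names of rationals -/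

theorem ratOfCode_natDiv (i : ℕ) {m : ℕ} (hm : 0 < m) :
    ((ratOfCode (i, 0, m - 1) : ℚ) : ℝ) = (i : ℝ) / m := by
  have : ((m - 1 : ℕ) : ℝ) + 1 = m := by
    rw [← Nat.cast_add_one, Nat.sub_add_cancel hm]
  simp [ratOfCode, this]

theorem exists_ratOfCode_eq (q : ℚ) : ∃ c, ratOfCode c = q := by
  refine ⟨(q.num.toNat, (-q.num).toNat, q.den - 1), ?_⟩
  have hd : ((q.den - 1 : ℕ) : ℚ) + 1 = q.den := by
    rw [← Nat.cast_add_one, Nat.sub_add_cancel q.pos]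
  have hn : ((q.num.toNat : ℕ) : ℚ) - ((-q.num).toNat : ℕ) = q.num := by
    have := Int.toNat_sub_toNat_neg q.num
    exact_mod_cast this
  simp only [ratOfCode, hd, hn]
  exact Rat.num_div_den q

/-! ### Schnorr random reals are irrational -/

theorem MartinLofRandom.schnorrRandom {x : ℝ} (hx : MartinLofRandom x) : SchnorrRandom x :=
  fun U hU => hx U hU.toIsMartinLofTest

theorem computableRealSeq_div_succ (C : ℕ) : ComputableRealSeq fun n => (C : ℝ) / (n + 1) := by
  refine ⟨fun p => (C, 0, p.1),
    (Computable.const C).pair ((Computable.const 0).pair Computable.fst), fun n k => ?_⟩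
  simp [ratOfCode]

theorem tendsto_const_div_succ (C : ℝ) :
    Tendsto (fun n : ℕ => C / ((n : ℝ) + 1)) atTop (𝓝 0) := by
  simpa [div_eq_mul_inv] using tendsto_one_div_add_atTop_nhds_zero_nat.const_mul C

/-- Intervals of radius `1 / (n + 1)` shrink to the rational, and their measures `2 / (n + 1)` are
known exactly. -/
theorem isSchnorrTest_Ioo_ratOfCode (c : ℕ × ℕ × ℕ) :
    IsSchnorrTest fun n : ℕ =>
      Ioo ((ratOfCode c : ℝ) - 1 / (n + 1)) ((ratOfCode c : ℝ) + 1 / (n + 1)) := by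
  obtain ⟨a, b, d⟩ := c
  have hvol : ∀ n : ℕ, volume (Ioo ((ratOfCode (a, b, d) : ℝ) - 1 / ((n : ℝ) + 1))
      ((ratOfCode (a, b, d) : ℝ) + 1 / (n + 1))) = ENNReal.ofReal ((2 : ℕ) / ((n : ℝ) + 1)) := by
    intro n
    rw [Real.volume_Ioo]
    congr 1
    push_cast
    ring
  -- Common denominator `(d + 1)(n + 1)`, lowered by one because names add one. The left endpoint
  -- enlarges the subtracted entry, the right endpoint the added one.
  refine ⟨⟨⟨fun p => ((a * (p.1 + 1), b * (p.1 + 1) + (d + 1), (d + 1) * (p.1 + 1) - 1),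
      (a * (p.1 + 1) + (d + 1), b * (p.1 + 1), (d + 1) * (p.1 + 1) - 1)), ?_, ?_⟩, ?_,
      fun n => ((2 : ℕ) : ℝ) / (n + 1), computableRealSeq_div_succ 2, tendsto_const_div_succ _,
      fun n => (hvol n).le⟩, ?_⟩
  · have h1 : Computable fun p : ℕ × ℕ => p.1 + 1 :=
      Computable.nat_add Computable.fst (Computable.const 1)
    have hm : ∀ e : ℕ, Computable fun p : ℕ × ℕ => e * (p.1 + 1) :=
      fun e => Computable.nat_mul (Computable.const e) h1
    have hden := Computable.nat_sub (hm (d + 1)) (Computable.const 1)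
    exact ((hm a).pair (((hm b).nat_add (Computable.const (d + 1))).pair hden)).pair
      (((hm a).nat_add (Computable.const (d + 1))).pair ((hm b).pair hden))
  · intro n
    dsimp only
    rw [iUnion_const]
    have hden : (((d + 1) * (n + 1) - 1 : ℕ) : ℝ) + 1 = ((d : ℝ) + 1) * (n + 1) := by
      rw [← Nat.cast_add_one, Nat.sub_add_cancel (Nat.mul_pos d.succ_pos n.succ_pos)]
      push_cast
      ring
    congr 1 <;>
    · simp only [ratOfCode]
      push_cast
      rw [hden]
      field_simp
      ring
  · intro m n hmn
    have h : 1 / ((n : ℝ) + 1) ≤ 1 / ((m : ℝ) + 1) := by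
      gcongr
    exact Ioo_subset_Ioo (by linarith) (by linarith)
  · convert computableRealSeq_div_succ 2 using 2 with n
    rw [hvol, ENNReal.toReal_ofReal (by positivity)]

/-- Needed because tests consist of open cells: an irrational point never lies on a cell boundary.
-/
theorem SchnorrRandom.irrational {x : ℝ} (hx : SchnorrRandom x) : Irrational x := by
  rintro ⟨q, rfl⟩
  obtain ⟨c, rfl⟩ := exists_ratOfCode_eq q
  refine hx _ (isSchnorrTest_Ioo_ratOfCode c) (mem_iInter.2 fun n => ?_)
  have : 0 < 1 / ((n : ℝ) + 1) := by positivity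
  exact ⟨by linarith, by linarith⟩

/-! ### An effective Borel–Cantelli lemma -/

/-- `⌊Q * y⌋₊` is the index of the cell of `y`, and each of the `Q` cells has measure `1 / Q`; the
measure is therefore a rational found by counting. -/
theorem volume_floor_mul_mem {Q : ℕ} (hQ : 0 < Q) (b : ℕ → ℕ) :
    volume {y : ℝ | y ∈ Ico (0 : ℝ) 1 ∧ b ⌊(Q : ℝ) * y⌋₊ ≠ 0} =
      ENNReal.ofReal (((∑ i ∈ Finset.range Q, min 1 (b i) : ℕ) : ℝ) / Q) := by
  have hQ' : (0 : ℝ) < Q := by exact_mod_cast hQ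
  have hset : {y : ℝ | y ∈ Ico (0 : ℝ) 1 ∧ b ⌊(Q : ℝ) * y⌋₊ ≠ 0} =
      ⋃ i ∈ (Finset.range Q).filter (fun i => b i ≠ 0), Ico ((i : ℝ) / Q) ((i + 1) / Q) := by
    ext y
    simp only [mem_ofPred_eq, mem_iUnion, Finset.mem_filter, Finset.mem_range, mem_Ico,
      exists_prop, div_le_iff₀ hQ', lt_div_iff₀ hQ']
    constructor
    · rintro ⟨⟨h0, h1⟩, hb⟩
      have hy : 0 ≤ (Q : ℝ) * y := by positivity
      refine ⟨_, ⟨(Nat.floor_lt hy).2 (by nlinarith), hb⟩, ?_, ?_⟩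
      · rw [mul_comm y]; exact Nat.floor_le hy
      · rw [mul_comm y]; exact Nat.lt_floor_add_one _
    · rintro ⟨i, ⟨hi, hb⟩, h1, h2⟩
      have hy : 0 ≤ y := by
        by_contra! h
        have : (0 : ℝ) ≤ i := i.cast_nonneg
        nlinarith
      have hi' : (i : ℝ) + 1 ≤ Q := by exact_mod_cast hi
      have hfl : ⌊(Q : ℝ) * y⌋₊ = i := by
        rw [Nat.floor_eq_iff (by positivity), mul_comm]
        exact ⟨h1, h2⟩
      refine ⟨⟨hy, ?_⟩, by rwa [hfl]⟩
      by_contra! h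
      nlinarith
  rw [hset, measure_biUnion_finset]
  · have : ∀ i : ℕ, volume (Ico ((i : ℝ) / Q) ((i + 1) / Q)) = ENNReal.ofReal (1 / Q) := by
      intro i
      rw [Real.volume_Ico]
      congr 1
      ring
    rw [Finset.sum_congr rfl fun i _ => this i, Finset.sum_const, nsmul_eq_mul]
    have hc : (∑ i ∈ Finset.range Q, min 1 (b i)) =
        ((Finset.range Q).filter (fun i => b i ≠ 0)).card := by
      rw [Finset.card_filter]
      refine Finset.sum_congr rfl fun i _ => ?_
      split_ifs with h <;> omega
    rw [hc, ← ENNReal.ofReal_natCast, ← ENNReal.ofReal_mul (by positivity)]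
    congr 1
    ring
  · intro i _ j _ hij
    refine Set.disjoint_left.2 fun y hy hy' => hij ?_
    simp only [mem_Ico, div_le_iff₀ hQ', lt_div_iff₀ hQ'] at hy hy'
    have h1 : (i : ℝ) < j + 1 := by linarith
    have h2 : (j : ℝ) < i + 1 := by linarith
    have h1' : i < j + 1 := by exact_mod_cast h1
    have h2' : j < i + 1 := by exact_mod_cast h2
    omega
  · exact fun i _ => measurableSet_Ico

theorem hasSum_div_sub_div (C : ℝ) (n : ℕ) (hC : 0 ≤ C) :
    HasSum (fun k : ℕ => C / ((n + k : ℕ) + 1) - C / ((n + k : ℕ) + 2)) (C / (n + 1)) := by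
  rw [hasSum_iff_tendsto_nat_of_nonneg]
  · have h : ∀ N : ℕ, ∑ k ∈ Finset.range N, (C / ((n + k : ℕ) + 1) - C / ((n + k : ℕ) + 2)) =
        C / (n + 1) - C / ((N + n : ℕ) + 1) := by
      intro N
      induction N with
      | zero => simp
      | succ N ih =>
        rw [Finset.sum_range_succ, ih]
        push_cast
        ring
    simp_rw [h]
    simpa using ((tendsto_const_div_succ C).comp (tendsto_add_atTop_nat n)).const_sub (C / (n + 1))
  · intro k
    rw [sub_nonneg]
    gcongr
    norm_num

/-- The union, over the `i` with `b i ≠ 0`, of the cells `[i / m, (i + 1) / m)` of `[0, 1)`. -/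
def gridSet (m : ℕ) (b : ℕ → ℕ) : Set ℝ :=
  {y : ℝ | y ∈ Ico (0 : ℝ) 1 ∧ b ⌊(m : ℝ) * y⌋₊ ≠ 0}

theorem mem_gridSet {m : ℕ} {b : ℕ → ℕ} {y : ℝ} :
    y ∈ gridSet m b ↔ y ∈ Ico (0 : ℝ) 1 ∧ b ⌊(m : ℝ) * y⌋₊ ≠ 0 := Iff.rfl

theorem mem_gridSet_of_mem_Ioo {m i : ℕ} {b : ℕ → ℕ} {y : ℝ} (hi : i < m) (hb : b i ≠ 0)
    (hy : y ∈ Ioo ((i : ℝ) / m) ((i + 1) / m)) : y ∈ gridSet m b := by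
  have hm : (0 : ℝ) < m := by exact_mod_cast i.zero_le.trans_lt hi
  have hi' : (i : ℝ) + 1 ≤ m := by exact_mod_cast hi
  have h0 : 0 ≤ y := le_trans (by positivity) hy.1.le
  have h1 : y < 1 := hy.2.trans_le ((div_le_one hm).2 hi')
  have hfl : ⌊(m : ℝ) * y⌋₊ = i := by
    rw [Nat.floor_eq_iff (by positivity), mul_comm]
    exact ⟨(div_le_iff₀ hm).1 hy.1.le, (lt_div_iff₀ hm).1 hy.2⟩
  exact ⟨⟨h0, h1⟩, by rwa [hfl]⟩

theorem exists_mem_Ioo_of_mem_gridSet {m : ℕ} (hm : 0 < m) {b : ℕ → ℕ} {y : ℝ}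
    (hirr : Irrational y) (hy : y ∈ gridSet m b) :
    ∃ i < m, b i ≠ 0 ∧ y ∈ Ioo ((i : ℝ) / m) ((i + 1) / m) := by
  have hm' : (0 : ℝ) < m := by exact_mod_cast hm
  obtain ⟨⟨h0, h1⟩, hb⟩ := hy
  have hmy : 0 ≤ (m : ℝ) * y := by positivity
  refine ⟨_, (Nat.floor_lt hmy).2 (by nlinarith), hb, lt_of_le_of_ne ?_ ?_, ?_⟩
  · rw [div_le_iff₀ hm', mul_comm y]
    exact Nat.floor_le hmy
  · intro h
    refine hirr ⟨(⌊(m : ℝ) * y⌋₊ : ℚ) / m, ?_⟩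
    push_cast
    exact h
  · rw [lt_div_iff₀ hm', mul_comm y]
    exact Nat.lt_floor_add_one _

/-- The cells of `gridSet (M j) (B j)` for `n ≤ j < J`, refined to the common grid of mesh
`1 / ∏ j < J, M j`. -/
def refinedIndicator (M : ℕ → ℕ) (B : ℕ → ℕ → ℕ) (n J i : ℕ) : ℕ :=
  -- The truncated factor `j + 1 - n` vanishes exactly for `j < n`, so it selects `n ≤ j`.
  ∑ j ∈ Finset.range J, (j + 1 - n) * B j (i / ((∏ l ∈ Finset.range J, M l) / M j))

/-- Each `M j` divides the product, so integer division of the fine cell index by the quotient gives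
the index of the coarse cell that contains it. -/
theorem biUnion_gridSet {M : ℕ → ℕ} (hM : ∀ j, 0 < M j) (B : ℕ → ℕ → ℕ) (n J : ℕ) :
    ⋃ j ∈ Finset.Ico n J, gridSet (M j) (B j) =
      gridSet (∏ l ∈ Finset.range J, M l) (refinedIndicator M B n J) := by
  ext y
  simp only [mem_iUnion, mem_gridSet, exists_prop, refinedIndicator, ne_eq, Finset.sum_eq_zero_iff,
    not_forall, Finset.mem_range, mul_eq_zero, not_or, Finset.mem_Ico]
  have key : ∀ j < J, ⌊((∏ l ∈ Finset.range J, M l : ℕ) : ℝ) * y⌋₊ /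
      ((∏ l ∈ Finset.range J, M l) / M j) = ⌊(M j : ℝ) * y⌋₊ := by
    intro j hj
    obtain ⟨r, hr⟩ := Finset.dvd_prod_of_mem M (Finset.mem_range.2 hj)
    have hr0 : 0 < r := by
      have : 0 < ∏ l ∈ Finset.range J, M l := Finset.prod_pos fun l _ => hM l
      rw [hr] at this
      exact Nat.pos_of_mul_pos_left this
    rw [hr, Nat.mul_div_cancel_left _ (hM j), ← Nat.floor_div_natCast]
    congr 1
    push_cast
    field_simp
  constructor
  · rintro ⟨j, ⟨hn, hJ⟩, hy, hb⟩
    exact ⟨hy, j, hJ, by omega, by rwa [key j hJ]⟩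
  · rintro ⟨hy, j, hJ, hn, hb⟩
    exact ⟨j, ⟨by omega, hJ⟩, hy, by rwa [key j hJ] at hb⟩

/-- The `k`-th interval in an enumeration of the open cells of the sets `gridSet (M j) (B j)`
with `j ≥ n`. -/
def gridInterval (M : ℕ → ℕ) (B : ℕ → ℕ → ℕ) (p : ℕ × ℕ) : (ℕ × ℕ × ℕ) × (ℕ × ℕ × ℕ) :=
  -- The factor `min 1 _` is 0 when the cell index is out of range or the cell is not selected; both
  -- endpoints are then 0 and the interval is empty.
  ((p.2.unpair.2 * min 1 ((M (p.1 + p.2.unpair.1) - p.2.unpair.2) *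
      B (p.1 + p.2.unpair.1) p.2.unpair.2), 0, M (p.1 + p.2.unpair.1) - 1),
    ((p.2.unpair.2 + 1) * min 1 ((M (p.1 + p.2.unpair.1) - p.2.unpair.2) *
      B (p.1 + p.2.unpair.1) p.2.unpair.2), 0, M (p.1 + p.2.unpair.1) - 1))

theorem computable_gridInterval {M : ℕ → ℕ} {B : ℕ → ℕ → ℕ} (hM : Computable M)
    (hB : Computable₂ B) : Computable (gridInterval M B) := by
  have hk : Computable fun p : ℕ × ℕ => p.2.unpair.1 :=
    Computable.fst.comp (Computable.unpair.comp Computable.snd)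
  have hi : Computable fun p : ℕ × ℕ => p.2.unpair.2 :=
    Computable.snd.comp (Computable.unpair.comp Computable.snd)
  have hj := Computable.fst.nat_add hk
  have hMj := hM.comp hj
  have hb := (Computable.const 1).nat_min ((hMj.nat_sub hi).nat_mul (hB.comp hj hi))
  have hden := (Computable.const 0).pair (hMj.nat_sub (Computable.const 1))
  exact ((hi.nat_mul hb).pair hden).pair (((hi.nat_add (Computable.const 1)).nat_mul hb).pair hden)

/-- The open set enumerated by `gridInterval`. -/
def gridOpen (M : ℕ → ℕ) (B : ℕ → ℕ → ℕ) (n : ℕ) : Set ℝ :=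
  ⋃ k : ℕ, Ioo (ratOfCode (gridInterval M B (n, k)).1 : ℝ)
    (ratOfCode (gridInterval M B (n, k)).2 : ℝ)

theorem mem_gridOpen {M : ℕ → ℕ} (hM : ∀ j, 0 < M j) {B : ℕ → ℕ → ℕ} {n : ℕ} {y : ℝ} :
    y ∈ gridOpen M B n ↔
      ∃ j ≥ n, ∃ i < M j, B j i ≠ 0 ∧ y ∈ Ioo ((i : ℝ) / M j) ((i + 1) / M j) := by
  simp only [gridOpen, mem_iUnion, gridInterval, ratOfCode_natDiv _ (hM _)]
  constructor
  · rintro ⟨k, hk⟩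
    by_cases h : (M (n + k.unpair.1) - k.unpair.2) * B (n + k.unpair.1) k.unpair.2 = 0
    · simp [h] at hk
    · have h1 : min 1 ((M (n + k.unpair.1) - k.unpair.2) * B (n + k.unpair.1) k.unpair.2) = 1 := by
        omega
      obtain ⟨h2, h3⟩ := mul_ne_zero_iff.1 h
      refine ⟨_, Nat.le_add_right _ _, _, by omega, h3, ?_⟩
      simpa [h1] using hk
  · rintro ⟨j, hj, i, hi, hb, hy⟩
    refine ⟨Nat.pair (j - n) i, ?_⟩
    have h1 : min 1 ((M j - i) * B j i) = 1 := by
      have : (M j - i) * B j i ≠ 0 := mul_ne_zero (by omega) hb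
      omega
    simpa [Nat.unpair_pair, Nat.add_sub_cancel' hj, h1] using hy

theorem antitone_gridOpen {M : ℕ → ℕ} (hM : ∀ j, 0 < M j) (B : ℕ → ℕ → ℕ) :
    Antitone (gridOpen M B) := by
  intro m n hmn y hy
  rw [mem_gridOpen hM] at hy ⊢
  obtain ⟨j, hj, h⟩ := hy
  exact ⟨j, hmn.trans hj, h⟩

/-- Open and half-open cells differ only at rational endpoints, a null set. -/
theorem gridOpen_ae_eq {M : ℕ → ℕ} (hM : ∀ j, 0 < M j) (B : ℕ → ℕ → ℕ) (n : ℕ) :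
    gridOpen M B n =ᵐ[volume] ⋃ k : ℕ, gridSet (M (n + k)) (B (n + k)) := by
  have hQ : ∀ᵐ y : ℝ, Irrational y :=
    (countable_range ((↑) : ℚ → ℝ)).ae_notMem volume
  filter_upwards [hQ] with y hy
  refine propext ⟨fun h => ?_, fun h => ?_⟩
  · obtain ⟨j, hj, i, hi, hb, hy⟩ := (mem_gridOpen hM).1 h
    refine mem_iUnion.2 ⟨j - n, ?_⟩
    rw [Nat.add_sub_cancel' hj]
    exact mem_gridSet_of_mem_Ioo hi hb hy
  · obtain ⟨k, hk⟩ := mem_iUnion.1 h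
    exact (mem_gridOpen hM).2 ⟨n + k, Nat.le_add_right _ _,
      exists_mem_Ioo_of_mem_gridSet (hM _) hy hk⟩

theorem volume_iUnion_gridSet_le {M : ℕ → ℕ} {B : ℕ → ℕ → ℕ} {C : ℕ}
    (hC : ∀ j : ℕ, volume (gridSet (M j) (B j)) ≤
      ENNReal.ofReal ((C : ℝ) / (j + 1) - C / (j + 2))) (n : ℕ) :
    volume (⋃ k : ℕ, gridSet (M (n + k)) (B (n + k))) ≤ ENNReal.ofReal ((C : ℝ) / (n + 1)) := by
  have hs := hasSum_div_sub_div C n C.cast_nonneg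
  refine (measure_iUnion_le _).trans ((ENNReal.tsum_le_tsum fun k => hC (n + k)).trans_eq ?_)
  rw [← hs.tsum_eq, ENNReal.ofReal_tsum_of_nonneg _ hs.summable]
  intro k
  rw [sub_nonneg]
  gcongr
  norm_num

/-- The telescoping bound makes the tail beyond `J` at most `C / (J + 1)`. The part below `J` lives
on one common grid, where its measure is an exact rational, so the measure of the union is
computable. -/
theorem isSchnorrTest_gridOpen {M : ℕ → ℕ} (hM : ∀ j, 0 < M j) (hMc : Computable M)
    {B : ℕ → ℕ → ℕ} (hBc : Computable₂ B) {C : ℕ}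
    (hC : ∀ j : ℕ, volume (gridSet (M j) (B j)) ≤
      ENNReal.ofReal ((C : ℝ) / (j + 1) - C / (j + 2))) :
    IsSchnorrTest (gridOpen M B) := by
  have hvol : ∀ n, volume (gridOpen M B n) =
      volume (⋃ k : ℕ, gridSet (M (n + k)) (B (n + k))) :=
    fun n => measure_congr (gridOpen_ae_eq hM B n)
  refine ⟨⟨⟨_, computable_gridInterval hMc hBc, fun _ => rfl⟩, antitone_gridOpen hM B,
    _, computableRealSeq_div_succ C, tendsto_const_div_succ _,
    fun n => (hvol n).trans_le (volume_iUnion_gridSet_le hC n)⟩, ?_⟩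
  -- Chosen so that the tail `C / (J + 1)` is at most `2 ^ (-k)`.
  let J : ℕ × ℕ → ℕ := fun p => p.1 + C * 2 ^ p.2
  let Q : ℕ → ℕ := fun J => ∏ l ∈ Finset.range J, M l
  have hQ0 : ∀ J, 0 < Q J := fun J => Finset.prod_pos fun l _ => hM l
  have hJc : Computable J :=
    Computable.fst.nat_add ((Computable.const C).nat_mul
      ((Computable.const 2).nat_pow Computable.snd))
  have hQc : Computable Q :=
    Computable.nat_prod_range (F := fun _ l => M l) (hMc.comp Computable.snd).to₂ Computable.id
  have hRc : Computable₂ fun (p : ℕ × ℕ) (i : ℕ) => min 1 (refinedIndicator M B p.1 (J p) i) := by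
    refine (Computable.const 1).nat_min (Computable.nat_sum_range
      (F := fun (q : (ℕ × ℕ) × ℕ) j => (j + 1 - q.1.1) * B j (q.2 / (Q (J q.1) / M j))) ?_
      (hJc.comp Computable.fst))
    have hq : Computable fun r : ((ℕ × ℕ) × ℕ) × ℕ => r.1.1 := Computable.fst.comp Computable.fst
    exact (((Computable.snd.nat_add (Computable.const 1)).nat_sub (Computable.fst.comp hq)).nat_mul
      (hBc.comp Computable.snd ((Computable.snd.comp Computable.fst).nat_div
        ((hQc.comp (hJc.comp hq)).nat_div (hMc.comp Computable.snd)))))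
  refine ⟨fun p => (∑ i ∈ Finset.range (Q (J p)), min 1 (refinedIndicator M B p.1 (J p) i), 0,
    Q (J p) - 1), (Computable.nat_sum_range hRc (hQc.comp hJc)).pair ((Computable.const 0).pair
      ((hQc.comp hJc).nat_sub (Computable.const 1))), fun n k => ?_⟩
  rw [ratOfCode_natDiv _ (hQ0 _)]
  dsimp only
  rw [hvol]
  set c : ℝ := ((∑ i ∈ Finset.range (Q (J (n, k))),
    min 1 (refinedIndicator M B n (J (n, k)) i) : ℕ) : ℝ) / (Q (J (n, k)) : ℕ) with hc
  have hc0 : 0 ≤ c := by positivity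
  have hW : volume (⋃ j ∈ Finset.Ico n (J (n, k)), gridSet (M j) (B j)) = ENNReal.ofReal c := by
    rw [biUnion_gridSet hM]
    exact volume_floor_mul_mem (hQ0 _) _
  have hle : ENNReal.ofReal c ≤ volume (⋃ k : ℕ, gridSet (M (n + k)) (B (n + k))) := by
    rw [← hW]
    refine measure_mono (iUnion₂_subset fun j hj => ?_)
    have := (Finset.mem_Ico.1 hj).1
    refine subset_iUnion_of_subset (j - n) ?_
    rw [Nat.add_sub_cancel' this]
  have hge : volume (⋃ k : ℕ, gridSet (M (n + k)) (B (n + k))) ≤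
      ENNReal.ofReal (c + (C : ℝ) / (J (n, k) + 1)) := by
    rw [ENNReal.ofReal_add hc0 (by positivity), ← hW]
    refine le_trans (measure_mono ?_) ((measure_union_le _ _).trans
      (add_le_add le_rfl (volume_iUnion_gridSet_le hC _)))
    refine iUnion_subset fun l => ?_
    by_cases hl : n + l < J (n, k)
    · exact subset_union_of_subset_left
        (subset_biUnion_of_mem (u := fun j => gridSet (M j) (B j))
          (Finset.mem_coe.2 (Finset.mem_Ico.2 ⟨Nat.le_add_right n l, hl⟩))) _
    · refine subset_union_of_subset_right (subset_iUnion_of_subset (n + l - J (n, k)) ?_) _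
      rw [Nat.add_sub_cancel' (not_lt.1 hl)]
  have h1 := ENNReal.toReal_mono (ne_top_of_le_ne_top ENNReal.ofReal_ne_top hge) hle
  have h2 := ENNReal.toReal_mono ENNReal.ofReal_ne_top hge
  rw [ENNReal.toReal_ofReal hc0] at h1
  rw [ENNReal.toReal_ofReal (by positivity)] at h2
  have h3 : (C : ℝ) / (J (n, k) + 1) ≤ (1 / 2) ^ k := by
    rw [div_le_iff₀ (by positivity), one_div, inv_pow, inv_mul_eq_div, le_div_iff₀ (by positivity)]
    simp only [J]
    push_cast
    have : (0 : ℝ) ≤ n := n.cast_nonneg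
    linarith
  rw [abs_le]
  exact ⟨by linarith [pow_nonneg (show (0 : ℝ) ≤ 1 / 2 by norm_num) k], by linarith⟩

/-- An effective Borel–Cantelli lemma: a Schnorr random real lies in only finitely many members
of a computable sequence of finite unions of rational cells of effectively summable measure. -/
theorem SchnorrRandom.eventually_floor_mul_eq_zero {x : ℝ} (hx : SchnorrRandom x)
    (hx01 : x ∈ Icc (0 : ℝ) 1) {M : ℕ → ℕ} (hM : ∀ j, 0 < M j) (hMc : Computable M)
    {B : ℕ → ℕ → ℕ} (hBc : Computable₂ B) {C : ℕ}
    (hC : ∀ j : ℕ, volume (gridSet (M j) (B j)) ≤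
      ENNReal.ofReal ((C : ℝ) / (j + 1) - C / (j + 2))) :
    ∀ᶠ j in atTop, B j ⌊(M j : ℝ) * x⌋₊ = 0 := by
  have h := hx _ (isSchnorrTest_gridOpen hM hMc hBc hC)
  simp only [mem_iInter, not_forall] at h
  obtain ⟨n, hn⟩ := h
  filter_upwards [eventually_ge_atTop n] with j hj
  by_contra hb
  have hx1 : x < 1 := lt_of_le_of_ne hx01.2 fun h => hx.irrational ⟨1, by simp [h]⟩
  exact hn ((mem_gridOpen hM).2 ⟨j, hj,
    exists_mem_Ioo_of_mem_gridSet (hM j) hx.irrational ⟨⟨hx01.1, hx1⟩, hb⟩⟩)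

/-! ### Recursive approximation of periodic functions of computable sequences -/

/-- Finite tables are recursive whatever their entries; this is why no computability of `θ` has to
be assumed later. -/
theorem computable_table (R : ℕ) (T : ℕ → ℕ) :
    ∃ τ : ℕ → ℕ, Computable τ ∧ ∀ r < R, τ r = T r := by
  refine ⟨fun r => ((List.range R).map T).getD r 0,
    ((Primrec.list_getD 0).comp (Primrec.const _) Primrec.id).to_comp, fun r hr => ?_⟩
  simp [List.getD, hr]

/-- The index `r < R` of the interval `[r / R, (r + 1) / R)` that contains the fractional part of
`ratOfCode c`. -/
def fractCell (R : ℕ) (c : ℕ × ℕ × ℕ) : ℕ :=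
  -- Modulo `c + 1` one has `-b ≡ b * c`, which avoids negative numerators.
  R * ((c.1 + c.2.1 * c.2.2) % (c.2.2 + 1)) / (c.2.2 + 1)

theorem computable_fractCell (R : ℕ) : Computable (fractCell R) := by
  have hb : Computable fun c : ℕ × ℕ × ℕ => c.2.1 := Computable.fst.comp Computable.snd
  have hc : Computable fun c : ℕ × ℕ × ℕ => c.2.2 := Computable.snd.comp Computable.snd
  have hc1 := hc.nat_add (Computable.const 1)
  exact ((Computable.const R).nat_mul
    ((Computable.fst.nat_add (hb.nat_mul hc)).nat_mod hc1)).nat_div hc1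

theorem fractCell_lt {R : ℕ} (hR : 0 < R) (c : ℕ × ℕ × ℕ) : fractCell R c < R := by
  rw [fractCell, Nat.div_lt_iff_lt_mul (Nat.succ_pos _)]
  exact Nat.mul_lt_mul_of_pos_left (Nat.mod_lt _ (Nat.succ_pos _)) hR

theorem exists_ratOfCode_sub_fractCell {R : ℕ} (hR : 0 < R) (c : ℕ × ℕ × ℕ) :
    ∃ z : ℤ, |(ratOfCode c : ℝ) - z - (fractCell R c : ℝ) / R| ≤ 1 / R := by
  obtain ⟨a, b, c⟩ := c
  have hR' : (0 : ℝ) < R := by exact_mod_cast hR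
  have hc : (0 : ℝ) < (c : ℝ) + 1 := by positivity
  set s := (a + b * c) % (c + 1) with hs
  set w := (a + b * c) / (c + 1) with hw
  have hsw : (a : ℝ) + b * c = (c + 1) * w + s := by
    have := Nat.div_add_mod (a + b * c) (c + 1)
    rw [← hs, ← hw] at this
    exact_mod_cast this.symm
  have hq : (ratOfCode (a, b, c) : ℝ) - ((w : ℤ) - (b : ℤ) : ℤ) = (s : ℝ) / (c + 1) := by
    simp only [ratOfCode]
    push_cast
    field_simp
    linarith
  refine ⟨(w : ℤ) - (b : ℤ), ?_⟩
  rw [hq]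
  have h1 := Nat.div_mul_le_self (R * s) (c + 1)
  have h2 := Nat.lt_div_mul_add (a := R * s) (b := c + 1) (Nat.succ_pos _)
  have hcell : fractCell R (a, b, c) = R * s / (c + 1) := rfl
  rw [← hcell] at h1 h2
  have h1' : (fractCell R (a, b, c) : ℝ) * (c + 1) ≤ R * s := by exact_mod_cast h1
  have h2' : (R : ℝ) * s < fractCell R (a, b, c) * (c + 1) + (c + 1) := by exact_mod_cast h2
  have e : (s : ℝ) / (c + 1) - (fractCell R (a, b, c) : ℝ) / R =
      (R * s - fractCell R (a, b, c) * (c + 1)) / ((c + 1) * R) := by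
    field_simp
  rw [e, abs_of_nonneg (div_nonneg (by linarith) (by positivity)), div_le_div_iff₀ (by positivity)
    hR']
  nlinarith

/-- Evaluate `u n` approximately at the left end of the cell, reduce modulo 1, round to one of `R`
classes and look up a rounded value of `θ`. The shift by 1 keeps the stored values natural numbers.
-/
theorem exists_computable_approx {u : ℕ → ℝ → ℝ} (hu : ComputableFunSeq u) {θ : ℝ → ℝ} {L : ℝ}
    (hper : Function.Periodic θ 1) (hθ : ∀ y, -1 ≤ θ y)
    (hL : ∀ y z, |θ y - θ z| ≤ L * |y - z|) {ε : ℝ} (hε : 0 < ε) :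
    ∃ D : ℕ, 0 < D ∧ ∃ t : ℕ × ℕ × ℕ → ℕ, Computable t ∧ ∃ e : ℕ → ℕ, Computable e ∧
      ∀ n m i : ℕ, 2 ^ e n ≤ m → i < m → ∀ y ∈ Icc ((i : ℝ) / m) ((i + 1) / m),
        |(t (n, i, m) : ℝ) / D - 1 - θ (u n y)| ≤ ε := by
  obtain ⟨⟨f, hf, hfapp⟩, d, hd, hdmod⟩ := hu
  have hL0 : 0 ≤ L := by simpa using (abs_nonneg _).trans (hL 0 1)
  -- Four errors of at most `ε / 4` each: moving to the grid point, approximating `u n` there,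
  -- rounding to a class modulo 1, and rounding `θ` to a multiple of `1 / D`. The first three are
  -- multiplied by `L`.
  obtain ⟨k, hk⟩ := exists_pow_lt_of_lt_one (show 0 < ε / (4 * (L + 1)) by positivity)
    (show (1 / 2 : ℝ) < 1 by norm_num)
  obtain ⟨R', hR'⟩ := exists_nat_one_div_lt (show 0 < ε / (4 * (L + 1)) by positivity)
  obtain ⟨D', hD'⟩ := exists_nat_one_div_lt (show 0 < ε / 4 by positivity)
  set R := R' + 1 with hRdef
  set D := D' + 1 with hDdef
  have hR : 0 < R := Nat.succ_pos _
  have hD : (0 : ℝ) < D := by positivity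
  obtain ⟨τ, hτ, hτT⟩ := computable_table R fun r => ⌊(D : ℝ) * (θ ((r : ℝ) / R) + 1)⌋₊
  have hfc : Computable fun p : ℕ × ℕ × ℕ => f (p.1, (p.2.1, 0, p.2.2 - 1), k) := by
    refine hf.comp (Computable.fst.pair (Computable.pair ((Computable.fst.comp
      Computable.snd).pair ((Computable.const 0).pair ?_)) (Computable.const k)))
    exact (Computable.snd.comp Computable.snd).nat_sub (Computable.const 1)
  refine ⟨D, Nat.succ_pos _, fun p => τ (fractCell R (f (p.1, (p.2.1, 0, p.2.2 - 1), k))),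
    hτ.comp ((computable_fractCell R).comp hfc), fun n => d (n, k),
    hd.comp (Computable.id.pair (Computable.const k)), fun n m i hm hi y hy => ?_⟩
  have hm0 : 0 < m := i.zero_le.trans_lt hi
  have hm0' : (0 : ℝ) < m := by exact_mod_cast hm0
  have hi' : (i : ℝ) + 1 ≤ m := by exact_mod_cast hi
  have hgrid : (i : ℝ) / m ∈ Icc (0 : ℝ) 1 :=
    ⟨by positivity, (div_le_one hm0').2 (by linarith)⟩
  have hy01 : y ∈ Icc (0 : ℝ) 1 :=
    ⟨hgrid.1.trans hy.1, hy.2.trans ((div_le_one hm0').2 hi')⟩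
  have h1 : |u n y - u n ((i : ℝ) / m)| ≤ (1 / 2) ^ k := by
    refine hdmod n k y hy01 _ hgrid ?_
    have hm' : (2 : ℝ) ^ d (n, k) ≤ m := by exact_mod_cast hm
    have : (1 : ℝ) / m ≤ (1 / 2) ^ d (n, k) := by
      rw [one_div_pow]
      exact one_div_le_one_div_of_le (by positivity) hm'
    have hy2 : y ≤ i / m + 1 / m := by rw [← add_div]; exact hy.2
    rw [abs_of_nonneg (sub_nonneg.2 hy.1)]
    linarith
  set c := f (n, (i, 0, m - 1), k) with hcdef
  have h2 : |u n ((i : ℝ) / m) - ratOfCode c| ≤ (1 / 2) ^ k := by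
    have := hfapp n (i, 0, m - 1) k
    rw [ratOfCode_natDiv i hm0] at this
    exact this hgrid
  obtain ⟨z, hz⟩ := exists_ratOfCode_sub_fractCell hR c
  have hperz : θ (ratOfCode c) = θ ((ratOfCode c : ℝ) - z) := by
    have := hper.sub_int_mul_eq (x := (ratOfCode c : ℝ)) z
    rw [mul_one] at this
    exact this.symm
  have g1 := (hL (u n y) (u n ((i : ℝ) / m))).trans (mul_le_mul_of_nonneg_left h1 hL0)
  have g2 := (hL (u n ((i : ℝ) / m)) (ratOfCode c)).trans (mul_le_mul_of_nonneg_left h2 hL0)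
  have g3 := (hL ((ratOfCode c : ℝ) - z) ((fractCell R c : ℝ) / R)).trans
    (mul_le_mul_of_nonneg_left hz hL0)
  rw [← hperz] at g3
  have g4 : |((τ (fractCell R c) : ℕ) : ℝ) / D - 1 - θ ((fractCell R c : ℝ) / R)| ≤ 1 / D := by
    rw [hτT _ (fractCell_lt hR c)]
    have h0 : 0 ≤ (D : ℝ) * (θ ((fractCell R c : ℝ) / R) + 1) :=
      mul_nonneg hD.le (by linarith [hθ ((fractCell R c : ℝ) / R)])
    have ha := Nat.floor_le h0
    have hb := Nat.lt_floor_add_one ((D : ℝ) * (θ ((fractCell R c : ℝ) / R) + 1))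
    have e : ∀ F t : ℝ, F / D - 1 - t = (F - D * (t + 1)) / D := by
      intro F t
      field_simp
      ring
    rw [e, abs_div, abs_of_pos hD]
    gcongr
    rw [abs_le]
    constructor <;> linarith
  have hRD : (1 : ℝ) / R < ε / (4 * (L + 1)) := by rw [hRdef]; push_cast; exact hR'
  have hDD : (1 : ℝ) / D < ε / 4 := by rw [hDdef]; push_cast; exact hD'
  have hLm : ∀ s : ℝ, s < ε / (4 * (L + 1)) → L * s ≤ ε / 4 := by
    intro s hs
    refine (mul_le_mul_of_nonneg_left hs.le hL0).trans ?_
    rw [mul_div_assoc', div_le_div_iff₀ (by positivity) (by norm_num)]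
    nlinarith
  have k1 := hLm _ hk
  have k2 := hLm _ hRD
  rw [abs_le] at g1 g2 g3 g4 ⊢
  constructor <;> linarith [g1.1, g1.2, g2.1, g2.2, g3.1, g3.2, g4.1, g4.2]

/-- If the quadratic means of the sums of `θ (u n y)` are small, then the averages along fourth
powers are eventually small at every Schnorr random point. -/
theorem SchnorrRandom.eventually_sum_le {x : ℝ} (hx : SchnorrRandom x)
    (hx01 : x ∈ Icc (0 : ℝ) 1) {u : ℕ → ℝ → ℝ} (hu : ComputableFunSeq u)
    (hcont : ∀ n, ContinuousOn (u n) (Icc 0 1)) {θ : ℝ → ℝ} {L : ℝ}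
    (hper : Function.Periodic θ 1) (hθ : ∀ y, -1 ≤ θ y) (hθc : Continuous θ)
    (hL : ∀ y z, |θ y - θ z| ≤ L * |y - z|) {C : ℕ}
    (hC : ∀ j : ℕ, ∫ y in Icc (0 : ℝ) 1, (∑ n ∈ Finset.range ((j + 1) ^ 4), θ (u n y)) ^ 2 ≤
      C * ((j : ℝ) + 1) ^ 6) {ε : ℝ} (hε : 0 < ε) :
    ∀ᶠ j : ℕ in atTop,
      ∑ n ∈ Finset.range ((j + 1) ^ 4), θ (u n x) ≤ ε * ((j : ℝ) + 1) ^ 4 := by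
  obtain ⟨E', hE'⟩ := exists_nat_one_div_lt hε
  set E := E' + 1 with hEdef
  have hE : (0 : ℝ) < E := by positivity
  have hEε : 1 / (E : ℝ) < ε := by rw [hEdef]; push_cast; exact hE'
  obtain ⟨D, hD, t, ht, e, he, happ⟩ :=
    exists_computable_approx hu hper hθ hL (show 0 < 1 / (4 * (E : ℝ)) by positivity)
  have hD' : (0 : ℝ) < D := by exact_mod_cast hD
  -- The sum of the exponents is a recursive upper bound for each of them, so this grid is fine
  -- enough for every term.
  let M : ℕ → ℕ := fun j => 2 ^ ∑ n ∈ Finset.range ((j + 1) ^ 4), e n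
  have hM : ∀ j, 0 < M j := fun j => Nat.pow_pos two_pos
  have hNc : Computable fun j : ℕ => (j + 1) ^ 4 :=
    (Computable.id.nat_add (Computable.const 1)).nat_pow (Computable.const 4)
  have hMc : Computable M := (Computable.const 2).nat_pow
    (Computable.nat_sum_range (F := fun _ n => e n) (he.comp Computable.snd).to₂ hNc)
  have hMe : ∀ j, ∀ n ∈ Finset.range ((j + 1) ^ 4), 2 ^ e n ≤ M j := fun j n hn =>
    Nat.pow_le_pow_right two_pos (Finset.single_le_sum (fun _ _ => Nat.zero_le _) hn)
  clear_value M
  -- With `N = (j + 1)^4`, truncated subtraction makes this nonzero exactly when the approximate sum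
  -- exceeds `N / (2E)`. As the error is at most `N / (4E)`, a nonzero value forces a true sum above
  -- `N / (4E)`, and zero forces one of at most `3N / (4E)`.
  set B : ℕ → ℕ → ℕ := fun j i => 2 * E * ∑ n ∈ Finset.range ((j + 1) ^ 4), t (n, i, M j) -
    (2 * E + 1) * D * (j + 1) ^ 4
  have hBc : Computable₂ B := by
    have hN2 : Computable fun p : ℕ × ℕ => (p.1 + 1) ^ 4 := hNc.comp Computable.fst
    have hT : Computable₂ fun (p : ℕ × ℕ) (n : ℕ) => t (n, p.2, M p.1) :=
      ht.comp (Computable.snd.pair ((Computable.snd.comp Computable.fst).pair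
        (hMc.comp (Computable.fst.comp Computable.fst))))
    have hS := Computable.nat_sum_range hT hN2
    exact ((Computable.const (2 * E)).nat_mul hS).nat_sub
      ((Computable.const ((2 * E + 1) * D)).nat_mul hN2)
  have hsum : ∀ j i, i < M j → ∀ y ∈ Icc ((i : ℝ) / M j) ((i + 1) / M j),
      |(∑ n ∈ Finset.range ((j + 1) ^ 4), (t (n, i, M j) : ℝ)) / D - ((j : ℝ) + 1) ^ 4 -
        ∑ n ∈ Finset.range ((j + 1) ^ 4), θ (u n y)| ≤ ((j : ℝ) + 1) ^ 4 * (1 / (4 * E)) := by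
    intro j i hi y hy
    have h1 : (∑ n ∈ Finset.range ((j + 1) ^ 4), (t (n, i, M j) : ℝ)) / D - ((j : ℝ) + 1) ^ 4 -
        ∑ n ∈ Finset.range ((j + 1) ^ 4), θ (u n y) =
        ∑ n ∈ Finset.range ((j + 1) ^ 4), ((t (n, i, M j) : ℝ) / D - 1 - θ (u n y)) := by
      rw [Finset.sum_sub_distrib, Finset.sum_sub_distrib, Finset.sum_div]
      simp
    rw [h1]
    refine (Finset.abs_sum_le_sum_abs _ _).trans ((Finset.sum_le_card_nsmul _ _ _
      fun n hn => happ n (M j) i ?_ hi y hy).trans_eq ?_)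
    · exact hMe j n hn
    · simp
  -- Markov's inequality at level `((j + 1)^4 / (4E))^2` gives `16 E² C / (j + 1)^2`; doubling the
  -- constant makes the bound telescope.
  have hvol : ∀ j : ℕ, volume (gridSet (M j) (B j)) ≤ ENNReal.ofReal
      (((32 * E ^ 2 * C : ℕ) : ℝ) / (j + 1) - ((32 * E ^ 2 * C : ℕ) : ℝ) / (j + 2)) := by
    intro j
    set g : ℝ → ℝ := fun y => (∑ n ∈ Finset.range ((j + 1) ^ 4), θ (u n y)) ^ 2 with hg
    set δ : ℝ := (((j : ℝ) + 1) ^ 4 * (1 / (4 * E))) ^ 2 with hδ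
    have hδ0 : 0 < δ := by positivity
    have hgint : IntegrableOn g (Icc 0 1) := by
      refine ContinuousOn.integrableOn_compact isCompact_Icc (ContinuousOn.pow ?_ 2)
      exact continuousOn_finsetSum _ fun n _ => hθc.comp_continuousOn (hcont n)
    have hsub : gridSet (M j) (B j) ⊆ {y | δ ≤ g y} ∩ Icc 0 1 := by
      intro y hy
      obtain ⟨hy01, hb⟩ := mem_gridSet.1 hy
      refine ⟨?_, Ico_subset_Icc_self hy01⟩
      have hMj : (0 : ℝ) < M j := by exact_mod_cast hM j
      have hMy : 0 ≤ (M j : ℝ) * y := mul_nonneg hMj.le hy01.1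
      set i := ⌊(M j : ℝ) * y⌋₊ with hi
      have hiM : i < M j := (Nat.floor_lt hMy).2 (by nlinarith [hy01.2])
      have happy := hsum j i hiM y ⟨by
        rw [div_le_iff₀ hMj, mul_comm y]; exact Nat.floor_le hMy, by
        rw [le_div_iff₀ hMj, mul_comm y]; exact (Nat.lt_floor_add_one _).le⟩
      have hb' : (2 * E + 1) * D * (j + 1) ^ 4 <
          2 * E * ∑ n ∈ Finset.range ((j + 1) ^ 4), t (n, i, M j) := by
        exact Nat.sub_ne_zero_iff_lt.1 hb
      have hb'' : (2 * (E : ℝ) + 1) * D * ((j : ℝ) + 1) ^ 4 <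
          2 * E * ∑ n ∈ Finset.range ((j + 1) ^ 4), (t (n, i, M j) : ℝ) := by
        exact_mod_cast hb'
      have hY : ((j : ℝ) + 1) ^ 4 * (1 / (2 * E)) <
          (∑ n ∈ Finset.range ((j + 1) ^ 4), (t (n, i, M j) : ℝ)) / D - ((j : ℝ) + 1) ^ 4 := by
        rw [lt_sub_iff_add_lt, lt_div_iff₀ hD']
        field_simp
        linarith
      have h2 : ((j : ℝ) + 1) ^ 4 * (1 / (2 * E)) = 2 * (((j : ℝ) + 1) ^ 4 * (1 / (4 * E))) := by
        field_simp
        ring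
      have h3 := (abs_le.1 happy).2
      change (((j : ℝ) + 1) ^ 4 * (1 / (4 * E))) ^ 2 ≤
        (∑ n ∈ Finset.range ((j + 1) ^ 4), θ (u n y)) ^ 2
      exact pow_le_pow_left₀ (by positivity) (by linarith) 2
    have hmarkov := mul_meas_ge_le_integral_of_nonneg
      (μ := volume.restrict (Icc (0 : ℝ) 1)) (f := g) (ae_of_all _ fun y => sq_nonneg _) hgint δ
    have hreal : (volume.restrict (Icc (0 : ℝ) 1)).real {y | δ ≤ g y} ≤
        ((32 * E ^ 2 * C : ℕ) : ℝ) / (j + 1) - ((32 * E ^ 2 * C : ℕ) : ℝ) / (j + 2) := by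
      have h1 := hmarkov.trans (hC j)
      rw [← le_div_iff₀' hδ0] at h1
      refine h1.trans ?_
      have hj : (0 : ℝ) ≤ j := j.cast_nonneg
      have e1 : (C : ℝ) * ((j : ℝ) + 1) ^ 6 / δ = 16 * E ^ 2 * C / ((j : ℝ) + 1) ^ 2 := by
        rw [hδ]
        field_simp
        ring
      have e2 : ((32 * E ^ 2 * C : ℕ) : ℝ) / (j + 1) - ((32 * E ^ 2 * C : ℕ) : ℝ) / (j + 2) =
          16 * E ^ 2 * C * 2 / ((j + 1) * (j + 2)) := by
        push_cast
        field_simp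
        ring
      rw [e1, e2, div_le_div_iff₀ (by positivity) (by positivity)]
      have : (0 : ℝ) ≤ 16 * E ^ 2 * C := by positivity
      have h4 : ((j : ℝ) + 1) * (j + 2) ≤ 2 * (j + 1) ^ 2 := by nlinarith
      nlinarith [mul_le_mul_of_nonneg_left h4 this]
    refine (measure_mono hsub).trans ((Measure.le_restrict_apply _ _).trans ?_)
    rw [← ofReal_measureReal]
    exact ENNReal.ofReal_le_ofReal hreal
  filter_upwards [hx.eventually_floor_mul_eq_zero hx01 hM hMc hBc hvol] with j hj
  have hMj : (0 : ℝ) < M j := by exact_mod_cast hM j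
  have hMx : 0 ≤ (M j : ℝ) * x := mul_nonneg hMj.le hx01.1
  have hx1 : x < 1 := lt_of_le_of_ne hx01.2 fun h => hx.irrational ⟨1, by simp [h]⟩
  set i := ⌊(M j : ℝ) * x⌋₊ with hi
  have hiM : i < M j := (Nat.floor_lt hMx).2 (by nlinarith)
  have happx := hsum j i hiM x ⟨by
    rw [div_le_iff₀ hMj, mul_comm x]; exact Nat.floor_le hMx, by
    rw [le_div_iff₀ hMj, mul_comm x]; exact (Nat.lt_floor_add_one _).le⟩
  have hb' : 2 * E * ∑ n ∈ Finset.range ((j + 1) ^ 4), t (n, i, M j) ≤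
      (2 * E + 1) * D * (j + 1) ^ 4 := by
    exact Nat.sub_eq_zero_iff_le.1 hj
  have hb'' : 2 * (E : ℝ) * ∑ n ∈ Finset.range ((j + 1) ^ 4), (t (n, i, M j) : ℝ) ≤
      (2 * (E : ℝ) + 1) * D * ((j : ℝ) + 1) ^ 4 := by
    exact_mod_cast hb'
  have hY : (∑ n ∈ Finset.range ((j + 1) ^ 4), (t (n, i, M j) : ℝ)) / D - ((j : ℝ) + 1) ^ 4 ≤
      ((j : ℝ) + 1) ^ 4 * (1 / (2 * E)) := by
    rw [sub_le_iff_le_add, div_le_iff₀ hD']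
    field_simp
    linarith
  have h2 : ((j : ℝ) + 1) ^ 4 * (1 / (2 * E)) + ((j : ℝ) + 1) ^ 4 * (1 / (4 * E)) ≤
      1 / E * ((j : ℝ) + 1) ^ 4 := by
    field_simp
    norm_num
  have h3 := (abs_le.1 happx).1
  have h4 : 1 / E * ((j : ℝ) + 1) ^ 4 ≤ ε * ((j : ℝ) + 1) ^ 4 := by gcongr
  linarith

/-! ### Van der Corput's estimate -/

/-- A form of the second mean value theorem for integrals. -/
theorem abs_integral_mul_le_of_antitoneOn {f F w : ℝ → ℝ} (hf : ContinuousOn f (Icc 0 1))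
    (hF : ContinuousOn F (Icc 0 1)) (hFf : ∀ x ∈ Ioo (0 : ℝ) 1, HasDerivAt F (f x) x)
    (hb : ∀ x ∈ Icc (0 : ℝ) 1, |F x| ≤ 1) (hw : ContinuousOn w (Icc 0 1))
    (hanti : AntitoneOn w (Icc 0 1)) (h0 : ∀ x ∈ Icc (0 : ℝ) 1, 0 ≤ w x) :
    |∫ x in (0 : ℝ)..1, f x * w x| ≤ 2 * w 0 := by
  obtain ⟨A, hA⟩ := isCompact_Icc.exists_bound_of_continuousOn hf
  have z01 : (0 : ℝ) ∈ Icc (0 : ℝ) 1 := by simp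
  have o01 : (1 : ℝ) ∈ Icc (0 : ℝ) 1 := by simp
  have hA0 : 0 ≤ A := (norm_nonneg _).trans (hA 0 z01)
  have hG : ∀ x ∈ Icc (0 : ℝ) 1, |F x - F 0| ≤ 2 := fun x hx =>
    (abs_sub _ _).trans (by linarith [hb x hx, hb 0 z01])
  have hint : ∀ x y : ℝ, 0 ≤ x → x ≤ y → y ≤ 1 → ∀ g : ℝ → ℝ, ContinuousOn g (Icc 0 1) →
      IntervalIntegrable g volume x y := fun x y hx hxy hy g hg =>
    (hg.mono (by rw [uIcc_of_le hxy]; exact Icc_subset_Icc hx hy)).intervalIntegrable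
  -- Abel summation on one short interval: freezing `w` at the right end costs at most `A * (y - x)
  -- * (w x - w y)`. Summed over `n + 1` equal intervals, the costs tend to 0, and `w` need not be
  -- differentiable.
  have key : ∀ x y : ℝ, 0 ≤ x → x ≤ y → y ≤ 1 →
      |(∫ t in x..y, f t * w t) + w x * (F x - F 0) - w y * (F y - F 0)| ≤
        (2 + A * (y - x)) * (w x - w y) := by
    intro x y hx hxy hy
    have hx1 : x ∈ Icc (0 : ℝ) 1 := ⟨hx, hxy.trans hy⟩
    have hy1 : y ∈ Icc (0 : ℝ) 1 := ⟨hx.trans hxy, hy⟩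
    have hftc : ∫ t in x..y, f t = F y - F x :=
      intervalIntegral.integral_eq_sub_of_hasDerivAt_of_le hxy (hF.mono (Icc_subset_Icc hx hy))
        (fun t ht => hFf t ⟨hx.trans_lt ht.1, ht.2.trans_le hy⟩) (hint x y hx hxy hy f hf)
    have hsplit : ∫ t in x..y, f t * w t =
        (∫ t in x..y, f t * (w t - w y)) + w y * (F y - F x) := by
      rw [← hftc, ← intervalIntegral.integral_const_mul, ← intervalIntegral.integral_add]
      · congr 1
        ext t
        ring
      · exact hint x y hx hxy hy _ (hf.mul (hw.sub continuousOn_const))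
      · exact hint x y hx hxy hy _ (continuousOn_const.mul hf)
    have hbd : |∫ t in x..y, f t * (w t - w y)| ≤ A * (w x - w y) * |y - x| := by
      rw [← Real.norm_eq_abs]
      refine intervalIntegral.norm_integral_le_of_norm_le_const fun t ht => ?_
      rw [uIoc_of_le hxy] at ht
      have ht1 : t ∈ Icc (0 : ℝ) 1 := ⟨hx.trans ht.1.le, ht.2.trans hy⟩
      have h1 := hanti hx1 ht1 ht.1.le
      have h2 := hanti ht1 hy1 ht.2
      rw [norm_mul, Real.norm_of_nonneg (sub_nonneg.2 h2)]
      exact mul_le_mul (hA t ht1) (by linarith) (by linarith) hA0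
    have hwxy := hanti hx1 hy1 hxy
    have hGw : |(w x - w y) * (F x - F 0)| ≤ (w x - w y) * 2 := by
      rw [abs_mul, abs_of_nonneg (by linarith)]
      exact mul_le_mul_of_nonneg_left (hG x hx1) (by linarith)
    rw [abs_of_nonneg (by linarith : 0 ≤ y - x)] at hbd
    have e : (∫ t in x..y, f t * w t) + w x * (F x - F 0) - w y * (F y - F 0) =
        (∫ t in x..y, f t * (w t - w y)) + (w x - w y) * (F x - F 0) := by
      rw [hsplit]; ring
    rw [e]
    refine (abs_add_le _ _).trans ((add_le_add hbd hGw).trans_eq ?_)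
    ring
  have hn : ∀ n : ℕ, |(∫ t in (0 : ℝ)..1, f t * w t) - w 1 * (F 1 - F 0)| ≤
      (2 + A * (1 / ((n : ℝ) + 1))) * (w 0 - w 1) := by
    intro n
    have hstep : ∀ m : ℕ, m ≤ n + 1 →
        |(∫ t in (0 : ℝ)..((m : ℝ) / (n + 1)), f t * w t) -
          w ((m : ℝ) / (n + 1)) * (F ((m : ℝ) / (n + 1)) - F 0)| ≤
        (2 + A * (1 / ((n : ℝ) + 1))) * (w 0 - w ((m : ℝ) / (n + 1))) := by
      intro m
      induction m with
      | zero => simp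
      | succ m ih =>
        intro hm
        have ih' := ih (by omega)
        have hx : 0 ≤ (m : ℝ) / (n + 1) := by positivity
        have hxy : (m : ℝ) / (n + 1) ≤ ((m + 1 : ℕ) : ℝ) / (n + 1) := by
          push_cast
          gcongr
          linarith
        have hy : ((m + 1 : ℕ) : ℝ) / (n + 1) ≤ 1 := by
          rw [div_le_one (by positivity)]
          exact_mod_cast hm
        have hk := key _ _ hx hxy hy
        have hd : ((m + 1 : ℕ) : ℝ) / (n + 1) - (m : ℝ) / (n + 1) = 1 / ((n : ℝ) + 1) := by
          push_cast
          ring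
        rw [hd] at hk
        rw [← intervalIntegral.integral_add_adjacent_intervals
          (hint _ _ le_rfl hx (hxy.trans hy) (fun t => f t * w t) (hf.mul hw))
          (hint _ _ hx hxy hy (fun t => f t * w t) (hf.mul hw))]
        rw [abs_le] at ih' hk ⊢
        constructor <;> linarith [ih'.1, ih'.2, hk.1, hk.2]
    have := hstep (n + 1) le_rfl
    rwa [Nat.cast_add_one, div_self (by positivity)] at this
  have hlim : |(∫ t in (0 : ℝ)..1, f t * w t) - w 1 * (F 1 - F 0)| ≤ 2 * (w 0 - w 1) := by
    have := (((tendsto_one_div_add_atTop_nhds_zero_nat (𝕜 := ℝ)).const_mul A).const_add 2).mul_const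
      (w 0 - w 1)
    rw [mul_zero, add_zero] at this
    exact ge_of_tendsto' this hn
  have h1 : |w 1 * (F 1 - F 0)| ≤ w 1 * 2 := by
    rw [abs_mul, abs_of_nonneg (h0 1 o01)]
    exact mul_le_mul_of_nonneg_left (hG 1 o01) (h0 1 o01)
  rw [abs_le] at hlim h1 ⊢
  constructor <;> linarith [hlim.1, hlim.2, h1.1, h1.2]

/-- The reflection `x ↦ 1 - x` reduces this to a decreasing weight. -/
theorem abs_integral_mul_le_of_monotoneOn {f F w : ℝ → ℝ} (hf : ContinuousOn f (Icc 0 1))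
    (hF : ContinuousOn F (Icc 0 1)) (hFf : ∀ x ∈ Ioo (0 : ℝ) 1, HasDerivAt F (f x) x)
    (hb : ∀ x ∈ Icc (0 : ℝ) 1, |F x| ≤ 1) (hw : ContinuousOn w (Icc 0 1))
    (hmono : MonotoneOn w (Icc 0 1)) (h0 : ∀ x ∈ Icc (0 : ℝ) 1, 0 ≤ w x) :
    |∫ x in (0 : ℝ)..1, f x * w x| ≤ 2 * w 1 := by
  have hr : ∀ x ∈ Icc (0 : ℝ) 1, 1 - x ∈ Icc (0 : ℝ) 1 :=
    fun x hx => ⟨by linarith [hx.2], by linarith [hx.1]⟩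
  have hc : ContinuousOn (fun x : ℝ => 1 - x) (Icc 0 1) := by fun_prop
  have h := abs_integral_mul_le_of_antitoneOn (f := fun x => f (1 - x))
    (F := fun x => -F (1 - x)) (w := fun x => w (1 - x)) (hf.comp hc hr) (hF.comp hc hr).neg
    (fun x hx => ?_) (fun x hx => by rw [abs_neg]; exact hb _ (hr x hx)) (hw.comp hc hr)
    (fun x hx y hy hxy => hmono (hr y hy) (hr x hx) (by linarith)) (fun x hx => h0 _ (hr x hx))
  · rw [intervalIntegral.integral_comp_sub_left (fun x => f x * w x) 1] at h
    simpa using h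
  · have h1 := hFf (1 - x) ⟨by linarith [hx.2], by linarith [hx.1]⟩
    have h2 := (h1.comp x ((hasDerivAt_id x).const_sub 1)).neg
    exact h2.congr_deriv (by simp)

/-- Write `cos g = (cos g * g') * (1 / g')`: the first factor is the derivative of `sin g`, the
second a monotone weight bounded by `1 / l`. -/
theorem abs_integral_cos_le_of_le {g g' : ℝ → ℝ} {l : ℝ} (hl : 0 < l)
    (hg : ContinuousOn g (Icc 0 1)) (hgg' : ∀ x ∈ Ioo (0 : ℝ) 1, HasDerivAt g (g' x) x)
    (hg' : ContinuousOn g' (Icc 0 1)) (hmono : MonotoneOn g' (Icc 0 1) ∨ AntitoneOn g' (Icc 0 1))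
    (hle : ∀ x ∈ Icc (0 : ℝ) 1, l ≤ g' x) :
    |∫ x in (0 : ℝ)..1, Real.cos (g x)| ≤ 2 / l := by
  have hpos : ∀ x ∈ Icc (0 : ℝ) 1, 0 < g' x := fun x hx => hl.trans_le (hle x hx)
  have e : ∫ x in (0 : ℝ)..1, Real.cos (g x) =
      ∫ x in (0 : ℝ)..1, (Real.cos (g x) * g' x) * (g' x)⁻¹ := by
    refine intervalIntegral.integral_congr fun x hx => ?_
    rw [uIcc_of_le zero_le_one] at hx
    rw [mul_assoc, mul_inv_cancel₀ (hpos x hx).ne', mul_one]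
  have hf : ContinuousOn (fun x => Real.cos (g x) * g' x) (Icc 0 1) :=
    (Real.continuous_cos.comp_continuousOn hg).mul hg'
  have hF : ContinuousOn (fun x => Real.sin (g x)) (Icc 0 1) :=
    Real.continuous_sin.comp_continuousOn hg
  have hw : ContinuousOn (fun x => (g' x)⁻¹) (Icc 0 1) := hg'.inv₀ fun x hx => (hpos x hx).ne'
  have hinv : ∀ x ∈ Icc (0 : ℝ) 1, 2 * (g' x)⁻¹ ≤ 2 / l := fun x hx => by
    rw [div_eq_mul_inv]
    exact mul_le_mul_of_nonneg_left (inv_anti₀ hl (hle x hx)) zero_le_two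
  rw [e]
  rcases hmono with hmono | hanti
  · refine (abs_integral_mul_le_of_antitoneOn hf hF (fun x hx => (hgg' x hx).sin)
      (fun x _ => Real.abs_sin_le_one _) hw (fun x hx y hy hxy => ?_)
      fun x hx => inv_nonneg.2 (hpos x hx).le).trans (hinv 0 (by simp))
    exact inv_anti₀ (hpos x hx) (hmono hx hy hxy)
  · refine (abs_integral_mul_le_of_monotoneOn hf hF (fun x hx => (hgg' x hx).sin)
      (fun x _ => Real.abs_sin_le_one _) hw (fun x hx y hy hxy => ?_)
      fun x hx => inv_nonneg.2 (hpos x hx).le).trans (hinv 1 (by simp))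
    exact inv_anti₀ (hpos y hy) (hanti hx hy hxy)

/-- A change of sign would produce a zero by the intermediate value theorem. -/
theorem le_of_le_abs_of_nonneg {D : ℝ → ℝ} {l : ℝ} (hl : 0 < l) (hD : ContinuousOn D (Icc 0 1))
    (habs : ∀ x ∈ Icc (0 : ℝ) 1, l ≤ |D x|) (h0 : 0 ≤ D 0) : ∀ x ∈ Icc (0 : ℝ) 1, l ≤ D x := by
  intro x hx
  rcases le_total 0 (D x) with h | h
  · simpa [abs_of_nonneg h] using habs x hx
  · obtain ⟨y, hy, hy0⟩ := isPreconnected_Icc.intermediate_value hx (by simp) hD ⟨h, h0⟩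
    have := habs y hy
    rw [hy0, abs_zero] at this
    linarith

theorem abs_integral_cos_le_of_le_abs {g g' : ℝ → ℝ} {l : ℝ} (hl : 0 < l)
    (hg : ContinuousOn g (Icc 0 1)) (hgg' : ∀ x ∈ Ioo (0 : ℝ) 1, HasDerivAt g (g' x) x)
    (hg' : ContinuousOn g' (Icc 0 1)) (hmono : MonotoneOn g' (Icc 0 1) ∨ AntitoneOn g' (Icc 0 1))
    (hle : ∀ x ∈ Icc (0 : ℝ) 1, l ≤ |g' x|) :
    |∫ x in (0 : ℝ)..1, Real.cos (g x)| ≤ 2 / l := by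
  rcases le_total 0 (g' 0) with h | h
  · exact abs_integral_cos_le_of_le hl hg hgg' hg' hmono (le_of_le_abs_of_nonneg hl hg' hle h)
  · have := abs_integral_cos_le_of_le hl hg.neg (fun x hx => (hgg' x hx).neg) hg'.neg
      (hmono.symm.imp (fun h => h.neg) fun h => h.neg)
      (le_of_le_abs_of_nonneg hl hg'.neg (fun x hx => by rw [abs_neg]; exact hle x hx)
        (by simpa using h))
    simpa using this

/-! ### Elementary sums -/

/-- Cruder than a logarithm, but enough for the exponent `3/2`. -/
theorem sum_one_div_succ_le (n : ℕ) :
    ∑ k ∈ Finset.range n, 1 / ((k : ℝ) + 1) ≤ 2 * √n := by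
  induction n with
  | zero => simp
  | succ n ih =>
    rw [Finset.sum_range_succ]
    have h1 : √((n + 1 : ℕ) : ℝ) ^ 2 = (n : ℝ) + 1 := by
      rw [Real.sq_sqrt (by positivity)]
      push_cast
      rfl
    have h2 : √(n : ℝ) ^ 2 = n := Real.sq_sqrt (by positivity)
    have h3 : 1 ≤ √((n + 1 : ℕ) : ℝ) :=
      Real.one_le_sqrt.2 (by push_cast; linarith [n.cast_nonneg (α := ℝ)])
    have h4 := Real.sqrt_nonneg (n : ℝ)
    rw [← h1]
    have h6 : 1 / √((n + 1 : ℕ) : ℝ) ^ 2 ≤ 2 * √((n + 1 : ℕ) : ℝ) - 2 * √(n : ℝ) := by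
      rw [div_le_iff₀ (by positivity)]
      have h5 : √(n : ℝ) ≤ √((n + 1 : ℕ) : ℝ) := Real.sqrt_le_sqrt (by push_cast; linarith)
      nlinarith [mul_nonneg (sub_nonneg.2 h5) (sub_nonneg.2 h3)]
    linarith

/-- A new row and a new column cost at most `2√N` each; the diagonal counts 0 because `1 / 0 = 0`.
-/
theorem sum_sum_one_div_abs_sub_le (N : ℕ) :
    ∑ i ∈ Finset.range N, ∑ j ∈ Finset.range N, 1 / |(i : ℝ) - j| ≤ 4 * (N * √N) := by
  induction N with
  | zero => simp
  | succ N ih =>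
    have h1 : ∑ j ∈ Finset.range N, 1 / |(N : ℝ) - j| ≤ 2 * √N := by
      refine (Eq.le ?_).trans (sum_one_div_succ_le N)
      rw [← Finset.sum_range_reflect]
      refine Finset.sum_congr rfl fun j hj => ?_
      have hj' := Finset.mem_range.1 hj
      have : ((N - 1 - j : ℕ) : ℝ) = N - 1 - j := by
        rw [Nat.sub_sub, Nat.cast_sub (by omega)]
        push_cast
        ring
      rw [this, show (N : ℝ) - (N - 1 - j) = j + 1 by ring, abs_of_nonneg (by positivity)]
    have h2 : ∑ i ∈ Finset.range N, 1 / |(i : ℝ) - N| = ∑ j ∈ Finset.range N, 1 / |(N : ℝ) - j| :=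
      Finset.sum_congr rfl fun i _ => by rw [abs_sub_comm]
    rw [Finset.sum_range_succ, Finset.sum_congr rfl fun i _ => Finset.sum_range_succ _ N,
      Finset.sum_add_distrib, Finset.sum_range_succ, h2]
    have h3 : √(N : ℝ) ≤ √((N + 1 : ℕ) : ℝ) := Real.sqrt_le_sqrt (by push_cast; linarith)
    have h4 := mul_le_mul_of_nonneg_left h3 (show (0 : ℝ) ≤ N + 1 by positivity)
    have h5 : (1 : ℝ) / |(N : ℝ) - N| = 0 := by simp
    rw [h5]
    push_cast at h4 ⊢
    linarith

/-- The right side is the squared modulus of the exponential sum, which does not depend on the phase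
`s`; the squared sine sum is dropped. -/
theorem sq_sum_cos_add_le (a : ℕ → ℝ) (s : ℝ) (N : ℕ) :
    (∑ n ∈ Finset.range N, Real.cos (a n + s)) ^ 2 ≤
      ∑ m ∈ Finset.range N, ∑ n ∈ Finset.range N, Real.cos (a m - a n) := by
  have h : ∑ m ∈ Finset.range N, ∑ n ∈ Finset.range N, Real.cos (a m - a n) =
      (∑ n ∈ Finset.range N, Real.cos (a n + s)) ^ 2 +
        (∑ n ∈ Finset.range N, Real.sin (a n + s)) ^ 2 := by
    rw [sq, sq, Finset.sum_mul_sum, Finset.sum_mul_sum, ← Finset.sum_add_distrib]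
    refine Finset.sum_congr rfl fun m _ => ?_
    rw [← Finset.sum_add_distrib]
    refine Finset.sum_congr rfl fun n _ => ?_
    rw [← Real.cos_sub]
    congr 1
    ring
  rw [h]
  exact le_add_of_nonneg_right (sq_nonneg _)

/-! ### Mean squares of exponential sums along Koksma sequences -/

namespace IsKoksmaWith

variable {K : ℝ} {u : ℕ → ℝ → ℝ}

theorem continuousOn_unitDeriv (hu : IsKoksmaWith K u) (n : ℕ) :
    ContinuousOn (unitDeriv u n) (Icc 0 1) :=
  (hu.contDiffOn n).continuousOn_derivWithin (uniqueDiffOn_Icc zero_lt_one) le_rfl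

theorem hasDerivAt (hu : IsKoksmaWith K u) (n : ℕ) {x : ℝ} (hx : x ∈ Ioo (0 : ℝ) 1) :
    HasDerivAt (u n) (unitDeriv u n x) x :=
  (((hu.contDiffOn n).differentiableOn one_ne_zero) x
    (Ioo_subset_Icc_self hx)).hasDerivWithinAt.hasDerivAt (Icc_mem_nhds hx.1 hx.2)

/-- The first `N` derivatives, put in increasing order, have gaps at least `K` everywhere. -/
theorem exists_perm_mul_abs_sub_le (hu : IsKoksmaWith K u) (hK : 0 < K) (N : ℕ) :
    ∃ σ : Equiv.Perm (Fin N), ∀ x ∈ Icc (0 : ℝ) 1, ∀ i j : Fin N,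
      K * |(i : ℝ) - j| ≤ |unitDeriv u (σ i) x - unitDeriv u (σ j) x| := by
  set a : Fin N → ℝ := fun n => unitDeriv u n 0
  have hmono := Tuple.monotone_sort a
  set σ := Tuple.sort a
  refine ⟨σ, fun x hx => ?_⟩
  -- The difference is nonnegative at 0 by the sorting and cannot change sign.
  have hgap : ∀ i j : Fin N, i < j → K ≤ unitDeriv u (σ j) x - unitDeriv u (σ i) x := by
    intro i j hij
    have hne : ((σ j : Fin N) : ℕ) ≠ σ i := fun h =>
      hij.ne' (σ.injective (Fin.ext h))
    refine le_of_le_abs_of_nonneg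
      (D := fun x => unitDeriv u (σ j) x - unitDeriv u (σ i) x) hK
      ((hu.continuousOn_unitDeriv _).sub (hu.continuousOn_unitDeriv _))
      (hu.le_abs_sub _ _ hne) ?_ x hx
    exact sub_nonneg.2 (hmono hij.le)
  have hlt : ∀ k : ℕ, ∀ i j : Fin N, (j : ℕ) = i + k →
      K * k ≤ unitDeriv u (σ j) x - unitDeriv u (σ i) x := by
    intro k
    induction k with
    | zero =>
      intro i j hij
      have : j = i := Fin.ext (by simpa using hij)
      simp [this]
    | succ k ih =>
      intro i j hij
      have h1 := ih i ⟨i + k, by omega⟩ rfl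
      have h2 := hgap ⟨i + k, by omega⟩ j (Fin.lt_def.2 (by simp only; omega))
      push_cast
      linarith
  have hle : ∀ i j : Fin N, i ≤ j →
      K * |(i : ℝ) - j| ≤ |unitDeriv u (σ i) x - unitDeriv u (σ j) x| := by
    intro i j hij
    have hij' : (i : ℕ) ≤ j := hij
    have h := hlt (j - i) i j (by omega)
    rw [Nat.cast_sub hij'] at h
    have h0 : (i : ℝ) ≤ j := by exact_mod_cast hij'
    rw [abs_sub_comm, abs_of_nonneg (sub_nonneg.2 h0), abs_sub_comm]
    exact h.trans (le_abs_self _)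
  intro i j
  rcases le_total i j with h | h
  · exact hle i j h
  · rw [abs_sub_comm, abs_sub_comm (unitDeriv u (σ i) x)]
    exact hle j i h

theorem abs_integral_cos_sub_le (hu : IsKoksmaWith K u) {h : ℕ} (hh : 0 < h) {l : ℝ} (hl : 0 < l)
    {m n : ℕ} (hmn : ∀ x ∈ Icc (0 : ℝ) 1, l ≤ |unitDeriv u m x - unitDeriv u n x|) :
    |∫ y in (0 : ℝ)..1, Real.cos (2 * Real.pi * h * u m y - 2 * Real.pi * h * u n y)| ≤ 1 / l := by
  have hh' : (1 : ℝ) ≤ h := by exact_mod_cast hh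
  have hc : 0 < 2 * Real.pi * h := by positivity
  have key := abs_integral_cos_le_of_le_abs (l := 2 * Real.pi * h * l)
    (g := fun y => 2 * Real.pi * h * u m y - 2 * Real.pi * h * u n y)
    (g' := fun y => 2 * Real.pi * h * (unitDeriv u m y - unitDeriv u n y)) (by positivity)
    ((continuousOn_const.mul (hu.contDiffOn m).continuousOn).sub
      (continuousOn_const.mul (hu.contDiffOn n).continuousOn))
    (fun x hx => by
      rw [mul_sub]
      exact ((hu.hasDerivAt m hx).const_mul _).sub ((hu.hasDerivAt n hx).const_mul _))
    (continuousOn_const.mul ((hu.continuousOn_unitDeriv m).sub (hu.continuousOn_unitDeriv n)))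
    ((hu.monotone_sub m n).imp
      (fun H x hx y hy hxy => mul_le_mul_of_nonneg_left (H hx hy hxy) hc.le)
      fun H x hx y hy hxy => mul_le_mul_of_nonneg_left (H hx hy hxy) hc.le)
    (fun x hx => by
      rw [abs_mul, abs_of_pos hc]
      exact mul_le_mul_of_nonneg_left (hmn x hx) hc.le)
  refine key.trans ?_
  rw [div_le_div_iff₀ (by positivity) hl]
  nlinarith [Real.pi_gt_three, mul_le_mul_of_nonneg_left hh' Real.pi_pos.le]

theorem integral_sq_sum_cos_le (hu : IsKoksmaWith K u) (hK : 0 < K) {h : ℕ} (hh : 0 < h) (s : ℝ)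
    (N : ℕ) :
    ∫ y in Icc (0 : ℝ) 1, (∑ n ∈ Finset.range N, Real.cos (2 * Real.pi * h * u n y + s)) ^ 2 ≤
      N + 4 / K * (N * √N) := by
  have hcont : ∀ n, ContinuousOn (fun y => 2 * Real.pi * h * u n y) (Icc 0 1) := fun n =>
    continuousOn_const.mul (hu.contDiffOn n).continuousOn
  have hcos : ∀ m n, ContinuousOn
      (fun y => Real.cos (2 * Real.pi * h * u m y - 2 * Real.pi * h * u n y)) (Icc 0 1) :=
    fun m n => Real.continuous_cos.comp_continuousOn ((hcont m).sub (hcont n))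
  set I : ℕ → ℕ → ℝ := fun m n =>
    ∫ y in Icc (0 : ℝ) 1, Real.cos (2 * Real.pi * h * u m y - 2 * Real.pi * h * u n y)
  have h1 : ∫ y in Icc (0 : ℝ) 1,
      (∑ n ∈ Finset.range N, Real.cos (2 * Real.pi * h * u n y + s)) ^ 2 ≤
      ∑ m ∈ Finset.range N, ∑ n ∈ Finset.range N, I m n := by
    have e : ∑ m ∈ Finset.range N, ∑ n ∈ Finset.range N, I m n = ∫ y in Icc (0 : ℝ) 1,
        ∑ m ∈ Finset.range N, ∑ n ∈ Finset.range N,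
          Real.cos (2 * Real.pi * h * u m y - 2 * Real.pi * h * u n y) := by
      rw [integral_finsetSum]
      · refine Finset.sum_congr rfl fun m _ => ?_
        rw [integral_finsetSum]
        exact fun n _ => (hcos m n).integrableOn_compact isCompact_Icc
      · exact fun m _ => (continuousOn_finsetSum _ fun n _ => hcos m n).integrableOn_compact
          isCompact_Icc
    rw [e]
    refine setIntegral_mono_on ?_ ?_ measurableSet_Icc
      fun y _ => sq_sum_cos_add_le (fun n => 2 * Real.pi * h * u n y) s N
    · exact ((continuousOn_finsetSum _ fun n _ => Real.continuous_cos.comp_continuousOn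
        ((hcont n).add continuousOn_const)).pow 2).integrableOn_compact isCompact_Icc
    · exact (continuousOn_finsetSum _ fun m _ => continuousOn_finsetSum _
        fun n _ => hcos m n).integrableOn_compact isCompact_Icc
  obtain ⟨σ, hσ⟩ := hu.exists_perm_mul_abs_sub_le hK N
  have hI : ∀ i j : Fin N, I (σ i) (σ j) ≤
      (if i = j then 1 else 0) + 1 / K * (1 / |(i : ℝ) - j|) := by
    intro i j
    split_ifs with hij
    · subst hij
      simp [I]
    · have hpos : 0 < |(i : ℝ) - j| := by
        rw [abs_pos, sub_ne_zero]
        exact fun h => hij (Fin.ext (by exact_mod_cast h))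
      have := hu.abs_integral_cos_sub_le hh (mul_pos hK hpos) fun x hx => hσ x hx i j
      rw [intervalIntegral.integral_of_le zero_le_one, ← integral_Icc_eq_integral_Ioc] at this
      rw [zero_add, one_div_mul_one_div]
      exact (le_abs_self _).trans this
  have h2 : ∑ m ∈ Finset.range N, ∑ n ∈ Finset.range N, I m n =
      ∑ i : Fin N, ∑ j : Fin N, I (σ i) (σ j) := by
    rw [Finset.sum_range, ← Equiv.sum_comp σ]
    refine Finset.sum_congr rfl fun i _ => ?_
    rw [Finset.sum_range, ← Equiv.sum_comp σ]
  have h3 : ∑ i : Fin N, ∑ j : Fin N, 1 / |(i : ℝ) - j| ≤ 4 * (N * √N) := by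
    refine (Eq.le ?_).trans (sum_sum_one_div_abs_sub_le N)
    rw [Finset.sum_range]
    exact Finset.sum_congr rfl fun i _ =>
      (Finset.sum_range fun j : ℕ => 1 / |((i : ℕ) : ℝ) - j|).symm
  refine h1.trans ?_
  rw [h2]
  refine (Finset.sum_le_sum fun i _ => Finset.sum_le_sum fun j _ => hI i j).trans ?_
  simp_rw [Finset.sum_add_distrib, ← Finset.mul_sum]
  have h4 := mul_le_mul_of_nonneg_left h3 (one_div_nonneg.2 hK.le)
  have h5 : ∑ i : Fin N, ∑ j : Fin N, (if i = j then (1 : ℝ) else 0) = N := by simp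
  rw [h5]
  refine (add_le_add le_rfl h4).trans_eq ?_
  ring

end IsKoksmaWith

/-! ### Exponential sums at Schnorr random points -/

/-- Between the fourth powers around `N` there are only `O(N^(3/4))` terms, each at most 1. -/
theorem eventually_sum_range_le_of_fourth_powers {c : ℕ → ℝ} (hc : ∀ n, c n ≤ 1)
    (h : ∀ ε > 0, ∀ᶠ j : ℕ in atTop,
      ∑ n ∈ Finset.range ((j + 1) ^ 4), c n ≤ ε * ((j : ℝ) + 1) ^ 4) {ε : ℝ} (hε : 0 < ε) :
    ∀ᶠ N : ℕ in atTop, ∑ n ∈ Finset.range N, c n ≤ ε * N := by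
  obtain ⟨j₀, hj₀⟩ := eventually_atTop.1 (h (ε / 2) (half_pos hε))
  -- With `q = j + 1`, the gap `(q + 1)^4 - q^4 ≤ 15 q^3` is at most `(ε / 2) q^4` once `ε q ≥ 30`.
  obtain ⟨k, hk⟩ := exists_nat_ge (30 / ε)
  filter_upwards [eventually_ge_atTop ((j₀ + k + 1) ^ 4)] with N hN
  obtain ⟨r, hr1, hr2⟩ : ∃ r : ℕ, r ^ 4 ≤ N ∧ N < (r + 1) ^ 4 := by
    refine ⟨N.sqrt.sqrt, ?_, ?_⟩
    · calc N.sqrt.sqrt ^ 4 = (N.sqrt.sqrt ^ 2) ^ 2 := by ring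
        _ ≤ N.sqrt ^ 2 := Nat.pow_le_pow_left (Nat.sqrt_le' _) 2
        _ ≤ N := Nat.sqrt_le' _
    · calc N < (N.sqrt + 1) ^ 2 := Nat.lt_succ_sqrt' _
        _ ≤ ((N.sqrt.sqrt + 1) ^ 2) ^ 2 := Nat.pow_le_pow_left (Nat.lt_succ_sqrt' _) 2
        _ = (N.sqrt.sqrt + 1) ^ 4 := by ring
  have hr : j₀ + k + 1 < r + 1 := lt_of_pow_lt_pow_left₀ 4 (Nat.zero_le _) (hN.trans_lt hr2)
  obtain ⟨j, rfl⟩ : ∃ j, r = j + 1 := ⟨r - 1, by omega⟩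
  have hj := hj₀ j (by omega)
  have hsplit : ∑ n ∈ Finset.range N, c n ≤
      ∑ n ∈ Finset.range ((j + 1) ^ 4), c n + (N - ((j : ℝ) + 1) ^ 4) := by
    rw [← Finset.sum_range_add_sum_Ico _ hr1]
    refine add_le_add le_rfl ((Finset.sum_le_card_nsmul _ _ 1 fun n _ => hc n).trans_eq ?_)
    rw [Nat.card_Ico, nsmul_eq_mul, mul_one, Nat.cast_sub hr1]
    push_cast
    ring
  have hr1' : ((j : ℝ) + 1) ^ 4 ≤ N := by exact_mod_cast hr1
  have hr2' : (N : ℝ) ≤ ((j : ℝ) + 1 + 1) ^ 4 := by exact_mod_cast hr2.le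
  have hkr : 30 ≤ ε * ((j : ℝ) + 1) := by
    have hk' : (k : ℝ) ≤ (j : ℝ) + 1 := by
      have : k ≤ j + 1 := by omega
      exact_mod_cast this
    rw [div_le_iff₀ hε] at hk
    nlinarith
  set q : ℝ := (j : ℝ) + 1 with hq
  have hq1 : 1 ≤ q := by rw [hq]; linarith [j.cast_nonneg (α := ℝ)]
  have h3 : (q + 1) ^ 4 - q ^ 4 ≤ 15 * q ^ 3 := by
    nlinarith [mul_nonneg (sub_nonneg.2 hq1) (sq_nonneg q), mul_nonneg (sub_nonneg.2 hq1)
      (zero_le_one.trans hq1)]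
  have h4 : 15 * q ^ 3 ≤ ε / 2 * q ^ 4 := by
    have := mul_le_mul_of_nonneg_right hkr (show 0 ≤ q ^ 3 by positivity)
    nlinarith
  have h5 : ε * q ^ 4 ≤ ε * N := mul_le_mul_of_nonneg_left hr1' hε.le
  linarith

theorem abs_cos_sub_cos_le (a b : ℝ) : |Real.cos a - Real.cos b| ≤ |a - b| := by
  simpa [Real.dist_eq] using Real.lipschitzWith_cos.dist_le_mul a b

theorem SchnorrRandom.eventually_sum_cos_le {x : ℝ} (hx : SchnorrRandom x)
    (hx01 : x ∈ Icc (0 : ℝ) 1) {u : ℕ → ℝ → ℝ} (hu : IsEffectiveKoksma u) {h : ℕ} (hh : 0 < h)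
    (s : ℝ) {ε : ℝ} (hε : 0 < ε) :
    ∀ᶠ N : ℕ in atTop,
      ∑ n ∈ Finset.range N, Real.cos (2 * Real.pi * h * u n x + s) ≤ ε * N := by
  obtain ⟨K, hK, hKu⟩ := hu.koksma
  refine eventually_sum_range_le_of_fourth_powers (fun n => Real.cos_le_one _) (fun ε hε => ?_) hε
  refine hx.eventually_sum_le hx01 hu.computable (fun n => (hKu.contDiffOn n).continuousOn)
    (θ := fun y => Real.cos (2 * Real.pi * h * y + s)) (L := 2 * Real.pi * h)
    (C := ⌈1 + 4 / K⌉₊) (fun y => ?_) (fun y => Real.neg_one_le_cos _) (by fun_prop)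
    (fun y z => ?_) (fun j => ?_) hε
  · have : 2 * Real.pi * h * (y + 1) + s = 2 * Real.pi * h * y + s + h * (2 * Real.pi) := by ring
    simp only [this, Real.cos_add_nat_mul_two_pi]
  · refine (abs_cos_sub_cos_le _ _).trans_eq ?_
    rw [add_sub_add_right_eq_sub, ← mul_sub, abs_mul, abs_of_nonneg (by positivity)]
  · refine (hKu.integral_sq_sum_cos_le hK hh s ((j + 1) ^ 4)).trans ?_
    have hs : √(((j + 1) ^ 4 : ℕ) : ℝ) = ((j : ℝ) + 1) ^ 2 := by
      rw [show (((j + 1) ^ 4 : ℕ) : ℝ) = (((j : ℝ) + 1) ^ 2) ^ 2 by push_cast; ring]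
      exact Real.sqrt_sq (by positivity)
    rw [hs]
    push_cast
    have hj : (1 : ℝ) ≤ (j : ℝ) + 1 := by linarith [j.cast_nonneg (α := ℝ)]
    have h1 : ((j : ℝ) + 1) ^ 4 ≤ ((j : ℝ) + 1) ^ 6 := pow_le_pow_right₀ hj (by norm_num)
    have h2 : (1 + 4 / K) * ((j : ℝ) + 1) ^ 6 ≤ ⌈1 + 4 / K⌉₊ * ((j : ℝ) + 1) ^ 6 :=
      mul_le_mul_of_nonneg_right (Nat.le_ceil _) (by positivity)
    have h3 : 4 / K * (((j : ℝ) + 1) ^ 4 * ((j : ℝ) + 1) ^ 2) = 4 / K * ((j : ℝ) + 1) ^ 6 := by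
      ring
    rw [h3]
    linarith

/-! ### Weyl's criterion -/

/-- The phases `0`, `π`, `π / 2` and `-π / 2` turn the one-sided bounds into bounds for `cos`,
`-cos`, `-sin` and `sin`. -/
theorem tendsto_average_fourier_of_eventually_sum_cos_le {x : ℕ → ℝ}
    (hx : ∀ h : ℕ, 0 < h → ∀ s : ℝ, ∀ ε > 0, ∀ᶠ N : ℕ in atTop,
      ∑ n ∈ Finset.range N, Real.cos (2 * Real.pi * h * x n + s) ≤ ε * N) {h : ℕ} (hh : 0 < h) :
    Tendsto (fun N : ℕ => (N : ℂ)⁻¹ * ∑ n ∈ Finset.range N, fourier h (x n : UnitAddCircle))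
      atTop (𝓝 0) := by
  rw [Metric.tendsto_nhds]
  intro ε hε
  have hε' : 0 < ε / 4 := by positivity
  filter_upwards [hx h hh 0 _ hε', hx h hh Real.pi _ hε', hx h hh (Real.pi / 2) _ hε',
    hx h hh (-(Real.pi / 2)) _ hε', eventually_gt_atTop 0] with N h1 h2 h3 h4 hN
  have hN' : (0 : ℝ) < N := by exact_mod_cast hN
  simp only [add_zero, Real.cos_add_pi, Real.cos_add_pi_div_two, Finset.sum_neg_distrib] at h1 h2 h3
  simp only [← sub_eq_add_neg, Real.cos_sub_pi_div_two] at h4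
  have e : ∀ n, fourier h (x n : UnitAddCircle) =
      Complex.cos ((2 * Real.pi * h * x n : ℝ)) +
        Complex.sin ((2 * Real.pi * h * x n : ℝ)) * Complex.I := by
    intro n
    rw [fourier_coe_apply, ← Complex.exp_mul_I]
    congr 1
    push_cast
    ring
  have hre : (∑ n ∈ Finset.range N, fourier h (x n : UnitAddCircle)).re =
      ∑ n ∈ Finset.range N, Real.cos (2 * Real.pi * h * x n) := by
    rw [Complex.re_sum]
    refine Finset.sum_congr rfl fun n _ => ?_
    rw [e]
    generalize (2 * Real.pi * h * x n : ℝ) = t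
    simp [Complex.cos_ofReal_re, Complex.sin_ofReal_re]
  have him : (∑ n ∈ Finset.range N, fourier h (x n : UnitAddCircle)).im =
      ∑ n ∈ Finset.range N, Real.sin (2 * Real.pi * h * x n) := by
    rw [Complex.im_sum]
    refine Finset.sum_congr rfl fun n _ => ?_
    rw [e]
    generalize (2 * Real.pi * h * x n : ℝ) = t
    simp [Complex.sin_ofReal_re]
  have hnorm := Complex.norm_le_abs_re_add_abs_im
    (∑ n ∈ Finset.range N, fourier h (x n : UnitAddCircle))
  rw [hre, him] at hnorm
  rw [dist_zero_right, norm_mul, norm_inv, Complex.norm_natCast, inv_mul_lt_iff₀ hN']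
  have h5 : |∑ n ∈ Finset.range N, Real.cos (2 * Real.pi * h * x n)| ≤ ε / 4 * N :=
    abs_le.2 ⟨by linarith, h1⟩
  have h6 : |∑ n ∈ Finset.range N, Real.sin (2 * Real.pi * h * x n)| ≤ ε / 4 * N :=
    abs_le.2 ⟨by linarith, h4⟩
  nlinarith

/-- Conjugation supplies the negative frequencies, linearity the trigonometric polynomials, and
their uniform density all continuous functions. -/
theorem tendsto_average_of_tendsto_average_fourier {x : ℕ → UnitAddCircle}
    (hx : ∀ h : ℕ, 0 < h →
      Tendsto (fun N : ℕ => (N : ℂ)⁻¹ * ∑ n ∈ Finset.range N, fourier h (x n)) atTop (𝓝 0))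
    (f : C(UnitAddCircle, ℂ)) :
    Tendsto (fun N : ℕ => (N : ℂ)⁻¹ * ∑ n ∈ Finset.range N, f (x n)) atTop
      (𝓝 (∫ y in (0 : ℝ)..1, f y)) := by
  have hcont : ∀ g : C(UnitAddCircle, ℂ), Continuous fun y : ℝ => g (y : UnitAddCircle) :=
    fun g => g.continuous.comp (AddCircle.continuous_mk' 1)
  have hfour : ∀ h : ℤ, ∫ y in (0 : ℝ)..1, fourier h (y : UnitAddCircle) =
      if h = 0 then 1 else 0 := by
    intro h
    have h1 := fourierCoeff_eq_intervalIntegral (T := 1) (fourier h) 0 0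
    rw [fourierCoeff_fourier] at h1
    simp only [neg_zero, fourier_zero, one_smul, zero_add, div_one] at h1
    rw [← h1, Pi.single_apply]
    simp [eq_comm]
  have hspan : ∀ g ∈ Submodule.span ℂ (range (@fourier 1)),
      Tendsto (fun N : ℕ => (N : ℂ)⁻¹ * ∑ n ∈ Finset.range N, g (x n)) atTop
        (𝓝 (∫ y in (0 : ℝ)..1, g y)) := by
    intro g hg
    induction hg using Submodule.span_induction with
    | mem g hg =>
      obtain ⟨h, rfl⟩ := hg
      rw [hfour]
      rcases lt_trichotomy h 0 with hneg | rfl | hpos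
      · obtain ⟨k, rfl⟩ : ∃ k : ℕ, h = -(k : ℤ) := ⟨h.natAbs, by omega⟩
        have hk := (Complex.continuous_conj.tendsto _).comp (hx k (by omega))
        rw [map_zero] at hk
        rw [if_neg hneg.ne]
        refine hk.congr fun N => ?_
        simp only [Function.comp_apply, map_mul, map_inv₀, map_natCast, map_sum, fourier_neg]
      · refine tendsto_const_nhds.congr' ?_
        filter_upwards [eventually_gt_atTop 0] with N hN
        have : (N : ℂ) ≠ 0 := by exact_mod_cast hN.ne'
        simp [this]
      · obtain ⟨k, rfl⟩ : ∃ k : ℕ, h = (k : ℤ) := ⟨h.natAbs, by omega⟩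
        rw [if_neg hpos.ne']
        exact hx k (by omega)
    | zero => simp
    | add g₁ g₂ _ _ h₁ h₂ =>
      have := h₁.add h₂
      rw [← intervalIntegral.integral_add ((hcont g₁).intervalIntegrable _ _)
        ((hcont g₂).intervalIntegrable _ _)] at this
      simpa [Finset.sum_add_distrib, mul_add] using this
    | smul c g _ h =>
      have := h.const_mul c
      rw [← intervalIntegral.integral_const_mul] at this
      simpa [← Finset.mul_sum, mul_left_comm] using this
  rw [Metric.tendsto_nhds]
  intro ε hε
  have hf : f ∈ (Submodule.span ℂ (range (@fourier 1))).topologicalClosure := by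
    rw [span_fourier_closure_eq_top]
    trivial
  obtain ⟨g, hg, hfg⟩ := Metric.mem_closure_iff.1 hf (ε / 3) (by positivity)
  rw [dist_eq_norm] at hfg
  filter_upwards [Metric.tendsto_nhds.1 (hspan g hg) (ε / 3) (by positivity)] with N hN
  have h1 : dist ((N : ℂ)⁻¹ * ∑ n ∈ Finset.range N, f (x n))
      ((N : ℂ)⁻¹ * ∑ n ∈ Finset.range N, g (x n)) ≤ ‖f - g‖ := by
    rw [dist_eq_norm, ← mul_sub, ← Finset.sum_sub_distrib, norm_mul, norm_inv,
      Complex.norm_natCast]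
    have : ‖∑ n ∈ Finset.range N, (f (x n) - g (x n))‖ ≤ N * ‖f - g‖ := by
      refine (norm_sum_le_of_le _ fun n _ => (f - g).norm_coe_le_norm (x n)).trans_eq ?_
      simp
    rcases N.eq_zero_or_pos with rfl | hN
    · simp
    · rw [inv_mul_le_iff₀ (by exact_mod_cast hN)]
      exact this
  have h2 : dist (∫ y in (0 : ℝ)..1, g y) (∫ y in (0 : ℝ)..1, f y) ≤ ‖f - g‖ := by
    rw [dist_comm, dist_eq_norm, ← intervalIntegral.integral_sub
      ((hcont f).intervalIntegrable _ _) ((hcont g).intervalIntegrable _ _)]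
    refine (intervalIntegral.norm_integral_le_of_norm_le_const
      fun y _ => (f - g).norm_coe_le_norm y).trans_eq ?_
    simp
  have h3 := dist_triangle4 ((N : ℂ)⁻¹ * ∑ n ∈ Finset.range N, f (x n))
    ((N : ℂ)⁻¹ * ∑ n ∈ Finset.range N, g (x n)) (∫ y in (0 : ℝ)..1, g y)
    (∫ y in (0 : ℝ)..1, f y)
  linarith

theorem tendsto_average_fract {x : ℕ → ℝ}
    (hx : ∀ f : C(UnitAddCircle, ℂ),
      Tendsto (fun N : ℕ => (N : ℂ)⁻¹ * ∑ n ∈ Finset.range N, f (x n : UnitAddCircle)) atTop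
        (𝓝 (∫ y in (0 : ℝ)..1, f y)))
    {p : ℝ → ℝ} (hp : Continuous p) (hp01 : p 0 = p 1) :
    Tendsto (fun N : ℕ => (N : ℝ)⁻¹ * ∑ n ∈ Finset.range N, p (Int.fract (x n))) atTop
      (𝓝 (∫ y in (0 : ℝ)..1, p y)) := by
  have hcont : Continuous (AddCircle.liftIco (1 : ℝ) 0 fun y => (p y : ℂ)) :=
    AddCircle.liftIco_zero_continuous (by simp [hp01])
      (Complex.continuous_ofReal.comp hp).continuousOn
  have happ : ∀ y : ℝ, AddCircle.liftIco (1 : ℝ) 0 (fun y => (p y : ℂ)) (y : UnitAddCircle) =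
      p (Int.fract y) := by
    intro y
    rw [← AddCircle.coe_fract y, AddCircle.liftIco_zero_coe_apply ⟨Int.fract_nonneg _, Int.fract_lt_one _⟩]
  have h := hx ⟨_, hcont⟩
  simp only [ContinuousMap.coe_mk, happ] at h
  have hint : ∫ y in (0 : ℝ)..1, (p (Int.fract y) : ℂ) = ((∫ y in (0 : ℝ)..1, p y : ℝ) : ℂ) := by
    rw [← intervalIntegral.integral_ofReal]
    refine intervalIntegral.integral_congr fun y hy => ?_
    rw [uIcc_of_le zero_le_one] at hy
    rcases hy.2.eq_or_lt with rfl | hy1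
    · simp [hp01]
    · simp only [Int.fract_eq_self.2 ⟨hy.1, hy1⟩]
  rw [hint] at h
  have h2 := (Complex.continuous_re.tendsto _).comp h
  rw [Complex.ofReal_re] at h2
  refine h2.congr fun N => ?_
  have : (N : ℂ)⁻¹ * ∑ n ∈ Finset.range N, (p (Int.fract (x n)) : ℂ) =
      (((N : ℝ)⁻¹ * ∑ n ∈ Finset.range N, p (Int.fract (x n)) : ℝ) : ℂ) := by
    push_cast
    rfl
  rw [Function.comp_apply, this, Complex.ofReal_re]

/-- The trapezoidal function that vanishes off `(a, b)` and equals `1` on `[a + δ, b - δ]`. -/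
noncomputable def trapezoid (a b δ y : ℝ) : ℝ := max 0 (min 1 (min (y - a) (b - y) / δ))

theorem continuous_trapezoid (a b δ : ℝ) : Continuous (trapezoid a b δ) := by
  unfold trapezoid
  fun_prop

theorem trapezoid_le_indicator {a b δ : ℝ} (hδ : 0 < δ) (y : ℝ) :
    trapezoid a b δ y ≤ (Ioo a b).indicator 1 y := by
  by_cases hy : y ∈ Ioo a b
  · rw [indicator_of_mem hy]
    exact max_le zero_le_one (min_le_left _ _)
  · rw [indicator_of_notMem hy]
    refine max_le le_rfl ((min_le_right _ _).trans (div_nonpos_of_nonpos_of_nonneg ?_ hδ.le))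
    rw [min_le_iff, sub_nonpos, sub_nonpos]
    by_contra! h
    exact hy ⟨h.1, h.2⟩

theorem trapezoid_nonneg (a b δ y : ℝ) : 0 ≤ trapezoid a b δ y := le_max_left _ _

theorem le_integral_trapezoid {a b δ : ℝ} (ha : 0 ≤ a) (hb : b ≤ 1) (hδ : 0 < δ)
    (hab : a + δ ≤ b - δ) : b - a - 2 * δ ≤ ∫ y in (0 : ℝ)..1, trapezoid a b δ y := by
  have h1 : ∫ y in (a + δ)..(b - δ), trapezoid a b δ y = b - a - 2 * δ := by
    have : ∫ y in (a + δ)..(b - δ), trapezoid a b δ y = ∫ _ in (a + δ)..(b - δ), (1 : ℝ) := by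
      refine intervalIntegral.integral_congr fun y hy => ?_
      rw [uIcc_of_le hab] at hy
      have : 1 ≤ min (y - a) (b - y) / δ := by
        rw [one_le_div hδ, le_min_iff]
        exact ⟨by linarith [hy.1], by linarith [hy.2]⟩
      simp [trapezoid, min_eq_left this]
    rw [this, intervalIntegral.integral_const, smul_eq_mul, mul_one]
    ring
  rw [← h1]
  exact intervalIntegral.integral_mono_interval (by linarith) hab (by linarith)
    (ae_of_all _ fun y => trapezoid_nonneg a b δ y)
    ((continuous_trapezoid a b δ).intervalIntegrable _ _)

theorem eventually_le_average_indicator {x : ℕ → ℝ}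
    (hx : ∀ p : ℝ → ℝ, Continuous p → p 0 = p 1 →
      Tendsto (fun N : ℕ => (N : ℝ)⁻¹ * ∑ n ∈ Finset.range N, p (Int.fract (x n))) atTop
        (𝓝 (∫ y in (0 : ℝ)..1, p y)))
    {a b : ℝ} (ha : 0 ≤ a) (hb : b ≤ 1) {ε : ℝ} (hε : 0 < ε) :
    ∀ᶠ N : ℕ in atTop, b - a - ε ≤
      (N : ℝ)⁻¹ * ∑ n ∈ Finset.range N, (Ioo a b).indicator (1 : ℝ → ℝ) (Int.fract (x n)) := by
  rcases le_total (b - a) ε with hab | hab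
  · refine Eventually.of_forall fun N => le_trans (by linarith) (mul_nonneg (by positivity)
      (Finset.sum_nonneg fun n _ => indicator_nonneg (fun _ _ => zero_le_one) _))
  · set δ := ε / 3 with hδ
    have hδ0 : 0 < δ := by positivity
    have h01 : trapezoid a b δ 0 = trapezoid a b δ 1 := by
      have h0 := trapezoid_le_indicator (a := a) (b := b) hδ0 0
      have h1 := trapezoid_le_indicator (a := a) (b := b) hδ0 1
      rw [indicator_of_notMem fun h => ha.not_gt h.1] at h0
      rw [indicator_of_notMem fun h => hb.not_gt h.2] at h1
      rw [h0.antisymm (trapezoid_nonneg _ _ _ _), h1.antisymm (trapezoid_nonneg _ _ _ _)]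
    have hI := le_integral_trapezoid ha hb hδ0 (by linarith)
    filter_upwards [(hx _ (continuous_trapezoid a b δ) h01).eventually_const_le
      (show b - a - ε < ∫ y in (0 : ℝ)..1, trapezoid a b δ y by linarith)] with N hN
    refine hN.trans (mul_le_mul_of_nonneg_left (Finset.sum_le_sum fun n _ =>
      trapezoid_le_indicator hδ0 _) (by positivity))

/-- Lower bounds suffice: those for `(0, a)` and `(b, 1)`, which are disjoint from `[a, b)`, bound
the frequency of `[a, b)` from above. -/
theorem UniformlyDistributedMod1.of_tendsto_average {x : ℕ → ℝ}
    (hx : ∀ p : ℝ → ℝ, Continuous p → p 0 = p 1 →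
      Tendsto (fun N : ℕ => (N : ℝ)⁻¹ * ∑ n ∈ Finset.range N, p (Int.fract (x n))) atTop
        (𝓝 (∫ y in (0 : ℝ)..1, p y))) :
    UniformlyDistributedMod1 x := by
  classical
  intro a b ha hab hb
  have hcount : ∀ N : ℕ, (({n : ℕ | n < N ∧ Int.fract (x n) ∈ Ico a b}.ncard : ℕ) : ℝ) / N =
      (N : ℝ)⁻¹ * ∑ n ∈ Finset.range N, (Ico a b).indicator (1 : ℝ → ℝ) (Int.fract (x n)) := by
    intro N
    have : {n : ℕ | n < N ∧ Int.fract (x n) ∈ Ico a b} =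
        ((Finset.range N).filter fun n => Int.fract (x n) ∈ Ico a b : Finset ℕ) := by
      ext n
      simp
    rw [this, ncard_coe_finset, Finset.card_filter, div_eq_inv_mul]
    push_cast
    simp [indicator_apply]
  simp_rw [hcount]
  have hsub : ∀ y : ℝ, (Ioo a b).indicator (1 : ℝ → ℝ) y ≤ (Ico a b).indicator 1 y := fun y =>
    indicator_le_indicator_of_subset Ioo_subset_Ico_self (fun _ => zero_le_one) y
  have hsum : ∀ y : ℝ, (Ico a b).indicator (1 : ℝ → ℝ) y + (Ioo 0 a).indicator 1 y +
      (Ioo b 1).indicator 1 y ≤ 1 := by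
    intro y
    simp only [indicator_apply, mem_Ico, mem_Ioo, Pi.one_apply]
    split_ifs <;> grind
  rw [Metric.tendsto_nhds]
  intro ε hε
  filter_upwards [eventually_le_average_indicator hx ha hb (ε := ε / 3) (by positivity),
    eventually_le_average_indicator hx le_rfl (hab.trans hb) (ε := ε / 3) (by positivity),
    eventually_le_average_indicator hx (ha.trans hab) le_rfl (ε := ε / 3) (by positivity),
    eventually_gt_atTop 0] with N h1 h2 h3 hN
  have hN' : (0 : ℝ) < N := by exact_mod_cast hN
  have h4 : (N : ℝ)⁻¹ * ∑ n ∈ Finset.range N, (Ioo a b).indicator (1 : ℝ → ℝ) (Int.fract (x n)) ≤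
      (N : ℝ)⁻¹ * ∑ n ∈ Finset.range N, (Ico a b).indicator (1 : ℝ → ℝ) (Int.fract (x n)) :=
    mul_le_mul_of_nonneg_left (Finset.sum_le_sum fun n _ => hsub _) (by positivity)
  have h5 := mul_le_mul_of_nonneg_left
    (Finset.sum_le_sum fun n (_ : n ∈ Finset.range N) => hsum (Int.fract (x n)))
    (inv_nonneg.2 hN'.le)
  rw [Finset.sum_add_distrib, Finset.sum_add_distrib, mul_add, mul_add, Finset.sum_const,
    Finset.card_range, nsmul_eq_mul, mul_one, inv_mul_cancel₀ hN'.ne'] at h5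
  rw [Real.dist_eq, abs_lt]
  constructor <;> linarith

theorem SchnorrRandom.effectiveKoksmaUD {x : ℝ} (hx : SchnorrRandom x)
    (hx01 : x ∈ Icc (0 : ℝ) 1) : EffectiveKoksmaUD x := fun _ hu =>
  UniformlyDistributedMod1.of_tendsto_average fun _ hp hp01 =>
    tendsto_average_fract (tendsto_average_of_tendsto_average_fourier fun _ hh =>
      tendsto_average_fourier_of_eventually_sum_cos_le
        (fun _ hh s _ hε => hx.eventually_sum_cos_le hx01 hu hh s hε) hh) hp hp01

theorem theorem1 :
    (∀ x : ℝ, x ∈ Set.Icc (0 : ℝ) 1 → SchnorrRandom x → EffectiveKoksmaUD x) ∧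
      (∀ x : ℝ, x ∈ Set.Icc (0 : ℝ) 1 → MartinLofRandom x → EffectiveKoksmaUD x) :=
  ⟨fun _ hx01 hx => hx.effectiveKoksmaUD hx01,
    fun _ hx01 hx => hx.schnorrRandom.effectiveKoksmaUD hx01⟩
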